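/- **Setting.** Let $\mathbb{K}$ be an algebraically closed field of characteristic zero, $r\geq 1$, $I=\{1,\dots,r\}$. Let $A=(A_{ij})_{i,j\in I}$ be an invertible generalised Cartan matrix, $\epsilon_i\in\mathbb{K}$ ($i\in I$) nonzero numbers such that $D^{-1}A$ is symmetric for $D=\mathrm{diag}(\epsilon_i)$, and $\lambda=\sum_i\lambda_i\Lambda_i$ a weight with $\lambda_i\in\mathbb{Z}_{\geq0}$. Let $B$ be the matrix indexed by $\{0\}\cup I$ with $B_{00}=0$, $B_{i0}=-\lambda_i$, $B_{0j}=-\lambda_j/\epsilon_j$, $B_{ij}=A_{ij}$ ($i,j\in I$), and assume that $B$ is invertible. Let $\mathscr{B}$ be the contragredient Lie superalgebra of $B$: the Lie superalgebra generated by odd $e_0,f_0$ and even $e_i,f_i$ ($i\in I$), $h_i$ ($i\in\{0\}\cup I$) with relations $[h_i,e_j]=B_{ij}e_j$, $[h_i,f_j]=-B_{ij}f_j$, $[e_i,f_j]=\delta_{ij}h_j$, modulo the maximal graded ideal intersecting the local part trivially (for the grading in which every $e_i$ has degree $1$ and every $f_i$ degree $-1$). Let $\mathfrak{g}\subset\mathscr{B}$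 be the Kac–Moody algebra generated by $e_i,f_i,h_i$, $i\in I$. Let $\langle-|-\rangle$ be the invariant bilinear form on $\mathscr{B}$ with $\mathbb{Z}_2$-graded symmetry given by $\langle e_i|f_j\rangle=0$ for $i\neq j$, $\langle e_0|f_0\rangle=1$, $\langle e_i|f_i\rangle=\epsilon_i$ ($i\in I$), let $\kappa$ be its restriction to $\mathfrak{g}$, and let $(-,-)$ be the form on weights of $\mathfrak{g}$ (the dual of $\mathfrak{h}=\langle h_i\rangle_{i\in I}$) induced by $\kappa$. Grade $\mathscr{B}=\bigoplus_k\mathscr{B}_k$ consistently, with $e_0,f_0$ of degrees $1,-1$ and all other generators of degree $0$, and let $L=\sum_{i=0}^r(B^{-1})_{0i}h_i\in\mathscr{B}_0$, which is its grading element. Write $[\![-,-]\!]$ for the bracket of $\mathscr{B}$. **Cartanification.** For $x_{\pm1}\in\mathscr{B}_{\pm1}$ and $y_{\pm1}\in\mathscr{B}_{\pm1}$ define elements of $U(\mathscr{B}_0)$ by $$x_{-1}y_1=-[\![y_1,x_{-1}]\!]+\langle x_{-1}|y_1\rangle L,\qquad x_1y_{-1}=[\![y_{-1},x_1]\!]+\langle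 x_1|y_{-1}\rangle L+\langle x_1|y_{-1}\rangle .$$ Let $\mathscr{B}_{\pm1}U(\mathscr{B}_0)=U(\mathscr{B}_0)\mathscr{B}_{\pm1}$ be the components of degree $\pm1$ of the enveloping algebras of $\mathscr{B}_0\oplus F(\mathscr{B}_{\pm1})$, where $F$ denotes the free Lie superalgebra and where $ax-xa=[\![a,x]\!]$ for $a\in\mathscr{B}_0$, $x\in\mathscr{B}_{\pm1}$. Extend the products above by $(ux_{\pm1})(y_{\mp1}v)=u(x_{\pm1}y_{\mp1})v$ for $u,v\in U(\mathscr{B}_0)$. With the supercommutator $[X,Y]=XY-(-1)^{XY}YX$ as bracket, $\mathscr{B}_{-1}U(\mathscr{B}_0)\oplus U(\mathscr{B}_0)\oplus\mathscr{B}_1U(\mathscr{B}_0)$ is a local Lie superalgebra. The *local cartanification* is its subalgebra generated by $\mathscr{B}_{-1}\mathscr{B}_0$ and $\mathscr{B}_1$, modulo the maximal graded ideal intersecting the component of degree $0$ trivially. The *cartanification* $\mathscr{B}^W$ is the minimal $\mathbb{Z}$-graded Lie superalgebra with this local part. **Pseudo-minuscule weights.** A weight $\mu=\sum_i\mu_i\Lambda_i$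 of $\mathfrak{g}$ is pseudo-minuscule if all $\mu_i$ are non-negative integers and $\big(\sum_i\epsilon_i\mu_i\Lambda_i,\alpha\big)\in\{0,1\}$ for every positive root $\alpha$ of $\mathfrak{g}$ (equivalently, it lies in $\{0,1,-1\}$ for every root $\alpha$). **Proposition 3.2.** Suppose that the weight $\lambda^{\blacktriangle}=\sum_i\frac{1}{\epsilon_i}\lambda_i\Lambda_i$ is pseudo-minuscule. Then, in the local cartanification, and hence in $\mathscr{B}^W$, $$f_0(h_0+L)=0,$$ and $f_0e_\beta=0$ for every root $\beta$ of $\mathfrak{g}$ with $(\lambda,\beta)=1$ and every root vector $e_\beta$ of $\beta$. In particular, $f_0e_j=0$ for every $j\in I$ with $\lambda_j\neq0$. -/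

import Mathlib

open scoped TensorProduct

namespace Cartanify

universe u v w

/-! ### Presentations of graded Lie superalgebras

A Lie superalgebra given by homogeneous generators and relations is the free non-associative algebra
on the generators modulo the super antisymmetry and the super Jacobi identity (imposed on all
pairs and triples of monomials, which are homogeneous) and the given relations. -/

section Presentations

/-- The monomial of a (non-associative) word. -/
noncomputable def mono (𝕂 : Type u) [Field 𝕂] {X : Type v} (a : FreeMagma X) :
    FreeNonUnitalNonAssocAlgebra 𝕂 X :=
  MonoidAlgebra.ofMagma 𝕂 (FreeMagma X) a

/-- The degree of a word, when each generator `x` has degree `d x`. -/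
def wordDeg {X : Type v} (d : X → ℤ) : FreeMagma X → ℤ
  | .of x => d x
  | .mul a b => wordDeg d a + wordDeg d b

/-- Generators and relations for a `ℤ`-graded Lie superalgebra. The generator `x` is even or odd as
`par x` is even or odd, and has `ℤ`-degree `deg x`. -/
structure Pres (𝕂 : Type u) [Field 𝕂] (X : Type v) where
  par : X → ℤ
  deg : X → ℤ
  rel : Set (FreeNonUnitalNonAssocAlgebra 𝕂 X)

variable {𝕂 : Type u} [Field 𝕂] {X : Type v}

/-- A two-sided ideal of a non-associative algebra. -/
def IsIdeal (J : Submodule 𝕂 (FreeNonUnitalNonAssocAlgebra 𝕂 X)) : Prop :=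
  ∀ a x, x ∈ J → a * x ∈ J ∧ x * a ∈ J

/-- The ideal generated by a set. -/
noncomputable def idealSpan (R : Set (FreeNonUnitalNonAssocAlgebra 𝕂 X)) :
    Submodule 𝕂 (FreeNonUnitalNonAssocAlgebra 𝕂 X) :=
  sInf {J | IsIdeal J ∧ R ⊆ J}

namespace Pres

variable (P : Pres 𝕂 X)

/-- The sign `(-1)^{|a||b|}` for two words. -/
def sgn (a b : FreeMagma X) : ℤ :=
  ((wordDeg P.par a * wordDeg P.par b).negOnePow : ℤˣ)

/-- Super antisymmetry, super Jacobi identity and the relations of the presentation. -/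
inductive AllRel : FreeNonUnitalNonAssocAlgebra 𝕂 X → Prop
  | antisymm (a b : FreeMagma X) :
      AllRel (mono 𝕂 a * mono 𝕂 b + P.sgn a b • (mono 𝕂 b * mono 𝕂 a))
  | jacobi (a b c : FreeMagma X) :
      AllRel (mono 𝕂 a * (mono 𝕂 b * mono 𝕂 c) - (mono 𝕂 a * mono 𝕂 b) * mono 𝕂 c
        - P.sgn a b • (mono 𝕂 b * (mono 𝕂 a * mono 𝕂 c)))
  | rel (x) (hx : x ∈ P.rel) : AllRel x

/-- The ideal of all consequences of the relations. The presented Lie superalgebra is the free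
algebra modulo this ideal. -/
noncomputable def relIdeal : Submodule 𝕂 (FreeNonUnitalNonAssocAlgebra 𝕂 X) :=
  idealSpan {x | P.AllRel x}

/-- The component of degree `k` of the free algebra. -/
noncomputable def piece (k : ℤ) : Submodule 𝕂 (FreeNonUnitalNonAssocAlgebra 𝕂 X) :=
  Submodule.span 𝕂 {x | ∃ a, wordDeg P.deg a = k ∧ mono 𝕂 a = x}

/-- The components of degree `-1`, `0` and `1`. -/
noncomputable def localPart : Submodule 𝕂 (FreeNonUnitalNonAssocAlgebra 𝕂 X) :=
  P.piece (-1) ⊔ P.piece 0 ⊔ P.piece 1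

/-- `J` is (the preimage in the free algebra of) a graded ideal of the presented Lie superalgebra
that intersects the local part trivially. -/
structure IsTrivialOnLocal (J : Submodule 𝕂 (FreeNonUnitalNonAssocAlgebra 𝕂 X)) : Prop where
  ideal : IsIdeal J
  graded : J ≤ ⨆ k, J ⊓ P.piece k
  relIdeal_le : P.relIdeal ≤ J
  local_le : J ⊓ P.localPart ≤ P.relIdeal

/-- (The preimage in the free algebra of) the maximal graded ideal that intersects the local part
trivially, that is, the sum of all such ideals. -/
noncomputable def maxIdeal : Submodule 𝕂 (FreeNonUnitalNonAssocAlgebra 𝕂 X) :=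
  P.relIdeal ⊔ sSup {J | P.IsTrivialOnLocal J}

/-- The presented Lie superalgebra modulo its maximal graded ideal that intersects the local part
trivially. -/
abbrev Alg : Type (max u v) := FreeNonUnitalNonAssocAlgebra 𝕂 X ⧸ P.maxIdeal

/-- The class of a generator. -/
noncomputable def gen (x : X) : P.Alg := P.maxIdeal.mkQ (mono 𝕂 (FreeMagma.of x))

theorem relIdeal_isIdeal : IsIdeal P.relIdeal := by
  intro a x hx
  rw [relIdeal, idealSpan, Submodule.mem_sInf] at hx
  constructor
  · rw [relIdeal, idealSpan, Submodule.mem_sInf]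
    exact fun J hJ => (hJ.1 a x (hx J hJ)).1
  · rw [relIdeal, idealSpan, Submodule.mem_sInf]
    exact fun J hJ => (hJ.1 a x (hx J hJ)).2

theorem allRel_mem {x} (hx : P.AllRel x) : x ∈ P.maxIdeal := by
  apply Submodule.mem_sup_left
  rw [relIdeal, idealSpan, Submodule.mem_sInf]
  exact fun J hJ => hJ.2 hx

theorem maxIdeal_isIdeal : IsIdeal P.maxIdeal := by
  have key : ∀ f : FreeNonUnitalNonAssocAlgebra 𝕂 X →ₗ[𝕂] FreeNonUnitalNonAssocAlgebra 𝕂 X,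
      (∀ J : Submodule 𝕂 (FreeNonUnitalNonAssocAlgebra 𝕂 X), IsIdeal J → ∀ x ∈ J, f x ∈ J) →
      P.maxIdeal ≤ P.maxIdeal.comap f := by
    intro f hf
    rw [maxIdeal]
    apply sup_le
    · intro x hx
      exact Submodule.mem_sup_left (hf _ P.relIdeal_isIdeal x hx)
    · apply sSup_le
      intro J hJ x hx
      exact Submodule.mem_sup_right ((le_sSup (a := J) hJ) (hf J hJ.ideal x hx))
  intro a x hx
  exact ⟨key (LinearMap.mulLeft 𝕂 a) (fun J hJ y hy => (hJ a y hy).1) hx,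
    key (LinearMap.mulRight 𝕂 a) (fun J hJ y hy => (hJ a y hy).2) hx⟩

/-- The bracket. -/
noncomputable def br : P.Alg →ₗ[𝕂] P.Alg →ₗ[𝕂] P.Alg :=
  (P.maxIdeal.liftQ
    (P.maxIdeal.liftQ
      ((LinearMap.mul 𝕂 (FreeNonUnitalNonAssocAlgebra 𝕂 X)).compr₂ P.maxIdeal.mkQ)
      (by
        intro x hx
        refine LinearMap.ext fun y => ?_
        simpa using (Submodule.Quotient.mk_eq_zero _).2 (P.maxIdeal_isIdeal y x hx).2)).flip
    (by
      intro y hy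
      refine LinearMap.ext fun x => ?_
      obtain ⟨x, rfl⟩ := P.maxIdeal.mkQ_surjective x
      exact (Submodule.Quotient.mk_eq_zero _).2 (P.maxIdeal_isIdeal x y hy).1)).flip

theorem br_mkQ (x y : FreeNonUnitalNonAssocAlgebra 𝕂 X) :
    P.br (P.maxIdeal.mkQ x) (P.maxIdeal.mkQ y) = P.maxIdeal.mkQ (x * y) := rfl

/-- The image of all words of `par`-degree `k`. When the relations are homogeneous for this degree
this is the component of degree `k` of the *consistent* `ℤ`-grading, whose even and odd parts are
the even and odd parts of the Lie superalgebra. -/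
noncomputable def gr (k : ℤ) : Submodule 𝕂 P.Alg :=
  Submodule.span 𝕂 {x | ∃ a, wordDeg P.par a = k ∧ P.maxIdeal.mkQ (mono 𝕂 a) = x}

theorem mono_mul (a b : FreeMagma X) : mono 𝕂 a * mono 𝕂 b = mono 𝕂 (a * b) :=
  ((MonoidAlgebra.ofMagma 𝕂 (FreeMagma X)).map_mul a b).symm

theorem wordDeg_mul (d : X → ℤ) (a b : FreeMagma X) :
    wordDeg d (a * b) = wordDeg d a + wordDeg d b := rfl

theorem gen_mem (x : X) : P.gen x ∈ P.gr (P.par x) :=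
  Submodule.subset_span ⟨FreeMagma.of x, rfl, rfl⟩

theorem br_mem {k l m : ℤ} (h : k + l = m) {x y : P.Alg} (hx : x ∈ P.gr k) (hy : y ∈ P.gr l) :
    P.br x y ∈ P.gr m := by
  subst h
  induction hx using Submodule.span_induction with
  | mem x hx =>
    obtain ⟨a, ha, rfl⟩ := hx
    induction hy using Submodule.span_induction with
    | mem y hy =>
      obtain ⟨b, hb, rfl⟩ := hy
      rw [br_mkQ, mono_mul]
      exact Submodule.subset_span ⟨a * b, by rw [wordDeg_mul, ha, hb], rfl⟩
    | zero => rw [map_zero]; exact Submodule.zero_mem _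
    | add y z _ _ h1 h2 => rw [map_add]; exact Submodule.add_mem _ h1 h2
    | smul c y _ h1 => rw [map_smul]; exact Submodule.smul_mem _ c h1
  | zero => rw [map_zero, LinearMap.zero_apply]; exact Submodule.zero_mem _
  | add y z _ _ h1 h2 => rw [map_add, LinearMap.add_apply]; exact Submodule.add_mem _ h1 h2
  | smul c y _ h1 => rw [map_smul, LinearMap.smul_apply]; exact Submodule.smul_mem _ c h1

theorem br_antisymm {k l : ℤ} {x y : P.Alg} (hx : x ∈ P.gr k) (hy : y ∈ P.gr l) :
    P.br x y + (((k * l).negOnePow : ℤˣ) : ℤ) • P.br y x = 0 := by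
  induction hx using Submodule.span_induction with
  | mem x hx =>
    obtain ⟨a, ha, rfl⟩ := hx
    induction hy using Submodule.span_induction with
    | mem y hy =>
      obtain ⟨b, hb, rfl⟩ := hy
      subst ha hb
      rw [br_mkQ, br_mkQ, ← map_zsmul, ← map_add]
      exact (Submodule.Quotient.mk_eq_zero _).2 (P.allRel_mem (AllRel.antisymm a b))
    | zero => simp
    | add y z _ _ h1 h2 =>
      simp only [map_add, LinearMap.add_apply, smul_add]
      rw [add_add_add_comm, h1, h2, add_zero]
    | smul c y _ h1 =>
      simp only [map_smul, LinearMap.smul_apply]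
      rw [smul_comm, ← smul_add, h1, smul_zero]
  | zero => simp
  | add y z _ _ h1 h2 =>
    simp only [map_add, LinearMap.add_apply, smul_add]
    rw [add_add_add_comm, h1, h2, add_zero]
  | smul c y _ h1 =>
    simp only [map_smul, LinearMap.smul_apply]
    rw [smul_comm, ← smul_add, h1, smul_zero]

theorem br_jacobi {k l m : ℤ} {x y z : P.Alg} (hx : x ∈ P.gr k) (hy : y ∈ P.gr l)
    (hz : z ∈ P.gr m) :
    P.br x (P.br y z) - P.br (P.br x y) z
      - (((k * l).negOnePow : ℤˣ) : ℤ) • P.br y (P.br x z) = 0 := by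
  induction hx using Submodule.span_induction with
  | mem x hx =>
    obtain ⟨a, ha, rfl⟩ := hx
    induction hy using Submodule.span_induction with
    | mem y hy =>
      obtain ⟨b, hb, rfl⟩ := hy
      induction hz using Submodule.span_induction with
      | mem z hz =>
        obtain ⟨c, hc, rfl⟩ := hz
        subst ha hb
        simp only [br_mkQ]
        rw [← map_zsmul, ← map_sub, ← map_sub]
        exact (Submodule.Quotient.mk_eq_zero _).2 (P.allRel_mem (AllRel.jacobi a b c))
      | zero => simp
      | add y z _ _ h1 h2 =>
        simp only [map_add, smul_add]
        rw [add_sub_add_comm, add_sub_add_comm, h1, h2, add_zero]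
      | smul c y _ h1 =>
        simp only [map_smul]
        rw [smul_comm, ← smul_sub, ← smul_sub, h1, smul_zero]
    | zero => simp
    | add y z _ _ h1 h2 =>
      simp only [map_add, LinearMap.add_apply, smul_add]
      rw [add_sub_add_comm, add_sub_add_comm, h1, h2, add_zero]
    | smul c y _ h1 =>
      simp only [map_smul, LinearMap.smul_apply]
      rw [smul_comm, ← smul_sub, ← smul_sub, h1, smul_zero]
  | zero => simp
  | add y z _ _ h1 h2 =>
    simp only [map_add, LinearMap.add_apply, smul_add]
    rw [add_sub_add_comm, add_sub_add_comm, h1, h2, add_zero]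
  | smul c y _ h1 =>
    simp only [map_smul, LinearMap.smul_apply]
    rw [smul_comm, ← smul_sub, ← smul_sub, h1, smul_zero]

/-- The bracket of the components of degrees `k` and `l`, as a map into the one of degree `m`. -/
noncomputable def grBr {k l m : ℤ} (h : k + l = m) : P.gr k →ₗ[𝕂] P.gr l →ₗ[𝕂] P.gr m :=
  LinearMap.mk₂ 𝕂 (fun x y => ⟨P.br x y, P.br_mem h x.2 y.2⟩)
    (fun x y z => Subtype.ext (by simp)) (fun c x y => Subtype.ext (by simp))
    (fun x y z => Subtype.ext (by simp)) (fun c x y => Subtype.ext (by simp))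

section LieInstances

variable [CharZero 𝕂]

/-- The component of degree `0` is a Lie algebra. -/
noncomputable instance : LieRing (P.gr 0) where
  bracket x y := P.grBr (zero_add 0) x y
  add_lie x y z := by simp
  lie_add x y z := by simp
  lie_self x := by
    have h := P.br_antisymm x.2 x.2
    simp only [mul_zero, Int.negOnePow_zero, Units.val_one, one_smul] at h
    have h2 : (2 : 𝕂) • P.br x x = 0 := by rw [two_smul]; exact h
    exact Subtype.ext ((smul_eq_zero.1 h2).resolve_left two_ne_zero)
  leibniz_lie x y z := by
    have h := P.br_jacobi x.2 y.2 z.2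
    simp only [mul_zero, Int.negOnePow_zero, Units.val_one, one_smul] at h
    apply Subtype.ext
    rw [sub_sub, sub_eq_zero] at h
    exact h

noncomputable instance : LieAlgebra 𝕂 (P.gr 0) where
  lie_smul c x y := by simp [Bracket.bracket]

/-- Each component is a module over the component of degree `0`. -/
noncomputable instance (k : ℤ) : LieRingModule (P.gr 0) (P.gr k) where
  bracket x y := P.grBr (zero_add k) x y
  add_lie x y z := by simp
  lie_add x y z := by simp
  leibniz_lie x y z := by
    have h := P.br_jacobi x.2 y.2 z.2
    simp only [mul_zero, Int.negOnePow_zero, Units.val_one, one_smul] at h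
    apply Subtype.ext
    rw [sub_sub, sub_eq_zero] at h
    exact h

noncomputable instance (k : ℤ) : LieModule 𝕂 (P.gr 0) (P.gr k) where
  smul_lie c x y := by simp [Bracket.bracket]
  lie_smul c x y := by simp [Bracket.bracket]

end LieInstances

end Pres

end Presentations

/-! ### Consistently graded local Lie superalgebras

The brackets of a local Lie superalgebra `N ⊕ Z ⊕ P` (degrees `-1`, `0`, `1`) with a consistent
grading, so that `N` and `P` are odd and `Z` is even. The remaining brackets are
`[n, z] = -[z, n]`, `[p, z] = -[z, p]` and `[n, p] = [p, n]`. -/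

section LocalAlgebras

/-- The brackets `[z, z']`, `[z, n]`, `[z, p]` and `[p, n]`. -/
structure LocalBr (𝕂 : Type u) [Field 𝕂] (N Z P : Type v)
    [AddCommGroup N] [Module 𝕂 N] [AddCommGroup Z] [Module 𝕂 Z] [AddCommGroup P] [Module 𝕂 P] where
  zz : Z →ₗ[𝕂] Z →ₗ[𝕂] Z
  zn : Z →ₗ[𝕂] N →ₗ[𝕂] N
  zp : Z →ₗ[𝕂] P →ₗ[𝕂] P
  pn : P →ₗ[𝕂] N →ₗ[𝕂] Z

namespace LocalBr

variable {𝕂 : Type u} [Field 𝕂] {N Z P : Type v}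
  [AddCommGroup N] [Module 𝕂 N] [AddCommGroup Z] [Module 𝕂 Z] [AddCommGroup P] [Module 𝕂 P]
  (G : LocalBr 𝕂 N Z P)

/-- The subspaces `n ⊕ z ⊕ p` form a subalgebra. -/
structure IsSubalgebra (n : Submodule 𝕂 N) (z : Submodule 𝕂 Z) (p : Submodule 𝕂 P) : Prop where
  zz : ∀ a ∈ z, ∀ b ∈ z, G.zz a b ∈ z
  zn : ∀ a ∈ z, ∀ b ∈ n, G.zn a b ∈ n
  zp : ∀ a ∈ z, ∀ b ∈ p, G.zp a b ∈ p
  pn : ∀ a ∈ p, ∀ b ∈ n, G.pn a b ∈ z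

/-- The component of degree `-1` of the subalgebra generated by `n₀ ⊆ N` and `p₀ ⊆ P`. -/
def genN (n₀ : Set N) (p₀ : Set P) : Submodule 𝕂 N :=
  sInf {n | ∃ z p, G.IsSubalgebra n z p ∧ n₀ ⊆ n ∧ p₀ ⊆ p}

/-- The component of degree `0` of the subalgebra generated by `n₀ ⊆ N` and `p₀ ⊆ P`. -/
def genZ (n₀ : Set N) (p₀ : Set P) : Submodule 𝕂 Z :=
  sInf {z | ∃ n p, G.IsSubalgebra n z p ∧ n₀ ⊆ n ∧ p₀ ⊆ p}

/-- The component of degree `1` of the subalgebra generated by `n₀ ⊆ N` and `p₀ ⊆ P`. -/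
def genP (n₀ : Set N) (p₀ : Set P) : Submodule 𝕂 P :=
  sInf {p | ∃ n z, G.IsSubalgebra n z p ∧ n₀ ⊆ n ∧ p₀ ⊆ p}

theorem subset_genN (n₀ : Set N) (p₀ : Set P) : n₀ ⊆ G.genN n₀ p₀ := by
  intro x hx
  rw [genN, SetLike.mem_coe, Submodule.mem_sInf]
  rintro n ⟨z, p, -, h, -⟩
  exact h hx

theorem gen_isSubalgebra (n₀ : Set N) (p₀ : Set P) :
    G.IsSubalgebra (G.genN n₀ p₀) (G.genZ n₀ p₀) (G.genP n₀ p₀) := by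
  constructor <;> intro a ha b hb <;>
    simp only [genN, genZ, genP, Submodule.mem_sInf, Set.mem_ofPred_eq] at ha hb ⊢
  · rintro z ⟨n, p, h, h1, h2⟩
    exact h.zz a (ha z ⟨n, p, h, h1, h2⟩) b (hb z ⟨n, p, h, h1, h2⟩)
  · rintro n ⟨z, p, h, h1, h2⟩
    exact h.zn a (ha z ⟨n, p, h, h1, h2⟩) b (hb n ⟨z, p, h, h1, h2⟩)
  · rintro p ⟨n, z, h, h1, h2⟩
    exact h.zp a (ha z ⟨n, p, h, h1, h2⟩) b (hb p ⟨n, z, h, h1, h2⟩)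
  · rintro z ⟨n, p, h, h1, h2⟩
    exact h.pn a (ha p ⟨n, z, h, h1, h2⟩) b (hb n ⟨z, p, h, h1, h2⟩)

/-- A bilinear map restricted to subspaces. -/
def restr₂ {A B C : Type v} [AddCommGroup A] [Module 𝕂 A] [AddCommGroup B] [Module 𝕂 B]
    [AddCommGroup C] [Module 𝕂 C] (f : A →ₗ[𝕂] B →ₗ[𝕂] C) {a : Submodule 𝕂 A}
    {b : Submodule 𝕂 B} {c : Submodule 𝕂 C} (h : ∀ x ∈ a, ∀ y ∈ b, f x y ∈ c) :
    a →ₗ[𝕂] b →ₗ[𝕂] c :=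
  LinearMap.mk₂ 𝕂 (fun x y => ⟨f x y, h x x.2 y y.2⟩)
    (fun x y z => Subtype.ext (by simp)) (fun r x y => Subtype.ext (by simp))
    (fun x y z => Subtype.ext (by simp)) (fun r x y => Subtype.ext (by simp))

/-- The subalgebra generated by `n₀ ⊆ N` and `p₀ ⊆ P`. -/
def generated (n₀ : Set N) (p₀ : Set P) :
    LocalBr 𝕂 (G.genN n₀ p₀) (G.genZ n₀ p₀) (G.genP n₀ p₀) where
  zz := restr₂ G.zz (G.gen_isSubalgebra n₀ p₀).zz
  zn := restr₂ G.zn (G.gen_isSubalgebra n₀ p₀).zn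
  zp := restr₂ G.zp (G.gen_isSubalgebra n₀ p₀).zp
  pn := restr₂ G.pn (G.gen_isSubalgebra n₀ p₀).pn

/-- `n ⊕ 0 ⊕ p` is an ideal. These are the *peripheral* ideals: those that intersect the component
of degree `0` trivially. -/
structure IsPeripheral (n : Submodule 𝕂 N) (p : Submodule 𝕂 P) : Prop where
  zn : ∀ a, ∀ b ∈ n, G.zn a b ∈ n
  zp : ∀ a, ∀ b ∈ p, G.zp a b ∈ p
  pn : ∀ a, ∀ b ∈ n, G.pn a b = 0
  pn' : ∀ a ∈ p, ∀ b, G.pn a b = 0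

/-- The component of degree `-1` of the maximal peripheral ideal (the sum of all of them). -/
def maxN : Submodule 𝕂 N := sSup {n | ∃ p, G.IsPeripheral n p}

/-- The component of degree `1` of the maximal peripheral ideal (the sum of all of them). -/
def maxP : Submodule 𝕂 P := sSup {p | ∃ n, G.IsPeripheral n p}

theorem max_isPeripheral : G.IsPeripheral G.maxN G.maxP where
  zn a := by
    change G.maxN ≤ G.maxN.comap (G.zn a)
    rw [maxN]
    apply sSup_le
    rintro n ⟨p, h⟩ b hb
    exact le_sSup (a := n) (Set.mem_ofPred.2 ⟨p, h⟩) (h.zn a b hb)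
  zp a := by
    change G.maxP ≤ G.maxP.comap (G.zp a)
    rw [maxP]
    apply sSup_le
    rintro p ⟨n, h⟩ b hb
    exact le_sSup (a := p) (Set.mem_ofPred.2 ⟨n, h⟩) (h.zp a b hb)
  pn a := by
    change G.maxN ≤ LinearMap.ker (G.pn a)
    rw [maxN]
    apply sSup_le
    rintro n ⟨p, h⟩ b hb
    exact h.pn a b hb
  pn' a ha b := by
    revert a
    change G.maxP ≤ LinearMap.ker (G.pn.flip b)
    rw [maxP]
    apply sSup_le
    rintro p ⟨n, h⟩ a ha
    exact h.pn' a ha b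

/-- The local Lie superalgebra modulo its maximal peripheral ideal. -/
noncomputable def modMax : LocalBr 𝕂 (N ⧸ G.maxN) Z (P ⧸ G.maxP) where
  zz := G.zz
  zn := (G.maxN.liftQ (G.zn.compr₂ G.maxN.mkQ).flip (by
    intro b hb
    refine LinearMap.ext fun a => ?_
    simpa using G.max_isPeripheral.zn a b hb)).flip
  zp := (G.maxP.liftQ (G.zp.compr₂ G.maxP.mkQ).flip (by
    intro b hb
    refine LinearMap.ext fun a => ?_
    simpa using G.max_isPeripheral.zp a b hb)).flip
  pn := (G.maxN.liftQ (G.maxP.liftQ G.pn (by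
      intro a ha
      refine LinearMap.ext fun b => ?_
      exact G.max_isPeripheral.pn' a ha b)).flip (by
    intro b hb
    refine LinearMap.ext fun a => ?_
    obtain ⟨a, rfl⟩ := G.maxP.mkQ_surjective a
    exact G.max_isPeripheral.pn a b hb)).flip

/-- Generators of the global Lie superalgebras with a given local part. -/
inductive Elt (N Z P : Type v) : Type v
  | neg (x : N)
  | zero (x : Z)
  | pos (x : P)

/-- The degree of a generator. -/
def Elt.degree : Elt N Z P → ℤ
  | .neg _ => -1
  | .zero _ => 0
  | .pos _ => 1

/-- A generator as an element of the free algebra. -/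
noncomputable def elt (𝕂 : Type u) [Field 𝕂] (x : Elt N Z P) :
    FreeNonUnitalNonAssocAlgebra 𝕂 (Elt N Z P) :=
  mono 𝕂 (FreeMagma.of x)

/-- All linear relations and all brackets of the local Lie superalgebra. -/
inductive GlobalRel : FreeNonUnitalNonAssocAlgebra 𝕂 (Elt N Z P) → Prop
  | neg_add (x y : N) : GlobalRel (elt 𝕂 (.neg (x + y)) - elt 𝕂 (.neg x) - elt 𝕂 (.neg y))
  | neg_smul (c : 𝕂) (x : N) : GlobalRel (elt 𝕂 (.neg (c • x)) - c • elt 𝕂 (.neg x))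
  | zero_add (x y : Z) : GlobalRel (elt 𝕂 (.zero (x + y)) - elt 𝕂 (.zero x) - elt 𝕂 (.zero y))
  | zero_smul (c : 𝕂) (x : Z) : GlobalRel (elt 𝕂 (.zero (c • x)) - c • elt 𝕂 (.zero x))
  | pos_add (x y : P) : GlobalRel (elt 𝕂 (.pos (x + y)) - elt 𝕂 (.pos x) - elt 𝕂 (.pos y))
  | pos_smul (c : 𝕂) (x : P) : GlobalRel (elt 𝕂 (.pos (c • x)) - c • elt 𝕂 (.pos x))
  | zz (x y : Z) : GlobalRel (elt 𝕂 (.zero x) * elt 𝕂 (.zero y) - elt 𝕂 (.zero (G.zz x y)))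
  | zn (x : Z) (y : N) : GlobalRel (elt 𝕂 (.zero x) * elt 𝕂 (.neg y) - elt 𝕂 (.neg (G.zn x y)))
  | zp (x : Z) (y : P) : GlobalRel (elt 𝕂 (.zero x) * elt 𝕂 (.pos y) - elt 𝕂 (.pos (G.zp x y)))
  | pn (x : P) (y : N) : GlobalRel (elt 𝕂 (.pos x) * elt 𝕂 (.neg y) - elt 𝕂 (.zero (G.pn x y)))

/-- The `ℤ`-graded Lie superalgebra generated by the local Lie superalgebra is its maximal global
extension; modulo the maximal graded ideal that intersects the local part trivially
(`G.minimal.Alg`) it is the minimal `ℤ`-graded Lie superalgebra with the given local part. -/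
noncomputable def minimal : Pres 𝕂 (Elt N Z P) where
  par := Elt.degree
  deg := Elt.degree
  rel := {x | G.GlobalRel x}

end LocalBr

end LocalAlgebras

/-! ### Cartanification -/

section Cartanification

/-- The structure of a consistently graded contragredient local Lie superalgebra `N ⊕ 𝔤 ⊕ P`, where
`𝔤` is a Lie algebra (the component of degree `0`) and the odd components `N` and `P` are
`𝔤`-modules: the bracket `⟦p, n⟧ = ⟦n, p⟧`, the bilinear map `⟨n|p⟩`, and the grading element. -/
structure ContraData (𝕂 : Type u) [Field 𝕂] (N 𝔤 P : Type v)
    [LieRing 𝔤] [LieAlgebra 𝕂 𝔤] [AddCommGroup N] [Module 𝕂 N] [AddCommGroup P] [Module 𝕂 P] where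
  pn : P →ₗ[𝕂] N →ₗ[𝕂] 𝔤
  form : N →ₗ[𝕂] P →ₗ[𝕂] 𝕂
  L : 𝔤

attribute [local instance] LieRing.ofAssociativeRing

section Actions

variable (𝕂 : Type u) [Field 𝕂] (𝔤 M : Type v) [LieRing 𝔤] [LieAlgebra 𝕂 𝔤]
  [AddCommGroup M] [Module 𝕂 M] [LieRingModule 𝔤 M] [LieModule 𝕂 𝔤 M]

local notation "U" => UniversalEnvelopingAlgebra 𝕂 𝔤

/-- For `M` the component of degree `±1`, the space `M U(𝔤)` in the enveloping algebra of
`𝔤 ⊕ F(M)` is `M ⊗ U(𝔤)`, where `x ⊗ u` is the product `x u`. This is multiplication by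
`a ∈ 𝔤` from the left: `a x u = [a, x] u + x a u`. -/
noncomputable def leftMul : 𝔤 →ₗ⁅𝕂⁆ Module.End 𝕂 (M ⊗[𝕂] U) where
  toFun a := TensorProduct.map (LieModule.toEnd 𝕂 𝔤 M a) LinearMap.id +
    TensorProduct.map LinearMap.id (LinearMap.mulLeft 𝕂 (UniversalEnvelopingAlgebra.ι 𝕂 a))
  map_add' a b := by
    apply TensorProduct.ext'
    intro x u
    simp [TensorProduct.add_tmul, TensorProduct.tmul_add, add_mul]
    abel
  map_smul' c a := by
    apply TensorProduct.ext'
    intro x u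
    simp [TensorProduct.smul_tmul']
  map_lie' {a b} := by
    apply TensorProduct.ext'
    intro x u
    simp [LieRing.of_associative_ring_bracket, TensorProduct.sub_tmul, TensorProduct.tmul_sub,
      sub_mul, mul_assoc]
    abel

/-- The same space is `U(𝔤) M = U(𝔤) ⊗ M`, where `u ⊗ x` is the product `u x`. This is
multiplication by `a ∈ 𝔤` from the right: `u x a = u a x - u [a, x]`. -/
noncomputable def rightMul : 𝔤 →ₗ⁅𝕂⁆ (Module.End 𝕂 (U ⊗[𝕂] M))ᵐᵒᵖ where
  toFun a := MulOpposite.op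
    (TensorProduct.map (LinearMap.mulRight 𝕂 (UniversalEnvelopingAlgebra.ι 𝕂 a)) LinearMap.id -
      TensorProduct.map LinearMap.id (LieModule.toEnd 𝕂 𝔤 M a))
  map_add' a b := by
    apply MulOpposite.unop_injective
    apply TensorProduct.ext'
    intro u x
    simp [TensorProduct.add_tmul, TensorProduct.tmul_add, mul_add]
    abel
  map_smul' c a := by
    apply MulOpposite.unop_injective
    apply TensorProduct.ext'
    intro u x
    simp [TensorProduct.smul_tmul', smul_sub]
  map_lie' {a b} := by
    apply MulOpposite.unop_injective
    apply TensorProduct.ext'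
    intro u x
    simp [LieRing.of_associative_ring_bracket, TensorProduct.sub_tmul, TensorProduct.tmul_sub,
      mul_sub, mul_assoc]
    abel

/-- The product `U(𝔤) × M U(𝔤) → M U(𝔤)`. -/
noncomputable def mulUM : U →ₗ[𝕂] (M ⊗[𝕂] U) →ₗ[𝕂] (M ⊗[𝕂] U) :=
  (UniversalEnvelopingAlgebra.lift 𝕂 (leftMul 𝕂 𝔤 M)).toLinearMap

/-- The product `M U(𝔤) × U(𝔤) → M U(𝔤)`, with the arguments interchanged. -/
noncomputable def mulMU : U →ₗ[𝕂] (M ⊗[𝕂] U) →ₗ[𝕂] (M ⊗[𝕂] U) :=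
  (TensorProduct.mapBilinear (RingHom.id 𝕂) M U M U LinearMap.id).comp (LinearMap.mul 𝕂 U).flip

/-- The identification of `M U(𝔤)` with `U(𝔤) M`. -/
noncomputable def toLeft : (M ⊗[𝕂] U) →ₗ[𝕂] (U ⊗[𝕂] M) :=
  TensorProduct.lift
    (((MulOpposite.opLinearEquiv 𝕂).symm.toLinearMap.comp
      (UniversalEnvelopingAlgebra.lift 𝕂 (rightMul 𝕂 𝔤 M)).toLinearMap).flip.comp
        (TensorProduct.mk 𝕂 U M 1))

end Actions

namespace ContraData

variable {𝕂 : Type u} [Field 𝕂] {N 𝔤 P : Type v} [LieRing 𝔤] [LieAlgebra 𝕂 𝔤]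
  [AddCommGroup N] [Module 𝕂 N] [LieRingModule 𝔤 N] [LieModule 𝕂 𝔤 N]
  [AddCommGroup P] [Module 𝕂 P] [LieRingModule 𝔤 P] [LieModule 𝕂 𝔤 P]
  (G : ContraData 𝕂 N 𝔤 P)

local notation "U" => UniversalEnvelopingAlgebra 𝕂 𝔤

/-- The product `x₋₁ y₁ = -⟦y₁, x₋₁⟧ + ⟨x₋₁|y₁⟩ L`. -/
noncomputable def mulNP : N →ₗ[𝕂] P →ₗ[𝕂] U :=
  -(G.pn.flip.compr₂ (UniversalEnvelopingAlgebra.ι 𝕂 : 𝔤 →ₗ⁅𝕂⁆ U).toLinearMap) +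
    G.form.compr₂ (LinearMap.toSpanSingleton 𝕂 U (UniversalEnvelopingAlgebra.ι 𝕂 G.L))

/-- The product `x₁ y₋₁ = ⟦y₋₁, x₁⟧ + ⟨x₁|y₋₁⟩ L + ⟨x₁|y₋₁⟩`, where `⟨x₁|y₋₁⟩ = -⟨y₋₁|x₁⟩`. -/
noncomputable def mulPN : P →ₗ[𝕂] N →ₗ[𝕂] U :=
  G.pn.compr₂ (UniversalEnvelopingAlgebra.ι 𝕂 : 𝔤 →ₗ⁅𝕂⁆ U).toLinearMap +
    (-G.form.flip).compr₂
      (LinearMap.toSpanSingleton 𝕂 U (UniversalEnvelopingAlgebra.ι 𝕂 G.L + 1))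

/-- Extension of a product `M × M' → U(𝔤)` by `(u x)(y v) = u (x y) v`. -/
noncomputable def extend {M M' : Type v} [AddCommGroup M] [Module 𝕂 M] [AddCommGroup M']
    [Module 𝕂 M'] (m : M →ₗ[𝕂] M' →ₗ[𝕂] U) :
    (U ⊗[𝕂] M) →ₗ[𝕂] (M' ⊗[𝕂] U) →ₗ[𝕂] U :=
  TensorProduct.lift (LinearMap.mk₂ 𝕂
    (fun u x => TensorProduct.lift ((LinearMap.mul 𝕂 U).comp
      ((LinearMap.mulLeft 𝕂 u).comp (m x))))
    (fun u u' x => by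
      apply TensorProduct.ext'
      intro y v
      simp [add_mul])
    (fun c u x => by
      apply TensorProduct.ext'
      intro y v
      simp)
    (fun u x x' => by
      apply TensorProduct.ext'
      intro y v
      simp [mul_add])
    (fun c u x => by
      apply TensorProduct.ext'
      intro y v
      simp))

@[simp] theorem extend_tmul {M M' : Type v} [AddCommGroup M] [Module 𝕂 M] [AddCommGroup M']
    [Module 𝕂 M'] (m : M →ₗ[𝕂] M' →ₗ[𝕂] U) (u v : U) (x : M) (y : M') :
    extend m (u ⊗ₜ[𝕂] x) (y ⊗ₜ[𝕂] v) = u * m x y * v := rfl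

/-- The local Lie superalgebra `N U(𝔤) ⊕ U(𝔤) ⊕ P U(𝔤)` whose bracket is the super commutator. -/
noncomputable def commutatorLocal : LocalBr 𝕂 (N ⊗[𝕂] U) U (P ⊗[𝕂] U) where
  zz := LinearMap.mul 𝕂 U - (LinearMap.mul 𝕂 U).flip
  zn := mulUM 𝕂 𝔤 N - mulMU 𝕂 𝔤 N
  zp := mulUM 𝕂 𝔤 P - mulMU 𝕂 𝔤 P
  pn := (extend G.mulPN).comp (toLeft 𝕂 𝔤 P) +
    ((extend G.mulNP).comp (toLeft 𝕂 𝔤 N)).flip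

/-- The elements `x₋₁ y₀`, which span `N 𝔤`. -/
def prodsNZ (_G : ContraData 𝕂 N 𝔤 P) : Set (N ⊗[𝕂] U) :=
  {t | ∃ (x : N) (y : 𝔤), t = x ⊗ₜ[𝕂] UniversalEnvelopingAlgebra.ι 𝕂 y}

/-- The elements of `P`. -/
def eltsP (_G : ContraData 𝕂 N 𝔤 P) : Set (P ⊗[𝕂] U) :=
  {t | ∃ x : P, t = x ⊗ₜ[𝕂] 1}

/-- The subalgebra generated by `N 𝔤` and `P`. -/
noncomputable abbrev subLocal :=
  G.commutatorLocal.generated G.prodsNZ G.eltsP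

/-- The local cartanification: the subalgebra generated by `N 𝔤` and `P`, modulo its maximal
peripheral ideal. -/
noncomputable abbrev localCart := G.subLocal.modMax

/-- The cartanification: the minimal `ℤ`-graded Lie superalgebra whose local part is the local
cartanification. -/
abbrev Cart := G.localCart.minimal.Alg

/-- The component of degree `-1` of the local cartanification. -/
abbrev LocalCartNeg := G.commutatorLocal.genN G.prodsNZ G.eltsP ⧸ G.subLocal.maxN

/-- The element `x₋₁ y₀` of the local cartanification. -/
noncomputable def prodLocal (x : N) (y : 𝔤) : G.LocalCartNeg :=
  G.subLocal.maxN.mkQ ⟨x ⊗ₜ[𝕂] UniversalEnvelopingAlgebra.ι 𝕂 y,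
    G.commutatorLocal.subset_genN _ _ ⟨x, y, rfl⟩⟩

/-- The element `x₋₁ y₀` of the cartanification. -/
noncomputable def prod (x : N) (y : 𝔤) : G.Cart :=
  G.localCart.minimal.gen (.neg (G.prodLocal x y))

end ContraData

end Cartanification

/-! ### The Lie superalgebra of a triple `(𝔤, λ, κ)` -/

section Triples

/-- The matrix `B` extending `A` by a row and a column `0`: `B₀₀ = 0`, `Bᵢ₀ = -λᵢ`,
`B₀ⱼ = -λⱼ/εⱼ` and `Bᵢⱼ = Aᵢⱼ`. -/
def extMatrix {𝕂 : Type u} [Field 𝕂] {r : ℕ} (A : Matrix (Fin r) (Fin r) ℤ) (ε : Fin r → 𝕂)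
    (lam : Fin r → ℕ) : Matrix (Fin (r + 1)) (Fin (r + 1)) 𝕂 :=
  Matrix.of fun i j =>
    Fin.cases (Fin.cases 0 (fun j => -((lam j : 𝕂) / ε j)) j)
      (fun i => Fin.cases (-(lam i : 𝕂)) (fun j => (A i j : 𝕂)) j) i

/-- The data `(𝔤, λ, κ)`: `A` is the Cartan matrix of `𝔤`, `ε i = κ(eᵢ, fᵢ)`, and
`lam` are the Dynkin labels of the dominant integral weight `λ`. -/
structure Triple (𝕂 : Type u) [Field 𝕂] (r : ℕ) where
  A : Matrix (Fin r) (Fin r) ℤ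
  ε : Fin r → 𝕂
  lam : Fin r → ℕ
  pos : 0 < r
  diag : ∀ i, A i i = 2
  offDiag : ∀ i j, i ≠ j → A i j ≤ 0
  zero_iff : ∀ i j, A i j = 0 ↔ A j i = 0
  det_ne : A.det ≠ 0
  ε_ne : ∀ i, ε i ≠ 0
  /-- `D⁻¹ A` is symmetric, where `D = diag(ε)`. -/
  symm : ∀ i j, (ε i)⁻¹ * (A i j : 𝕂) = (ε j)⁻¹ * (A j i : 𝕂)
  det_ext_ne : (extMatrix A ε lam).det ≠ 0

/-- The Chevalley generators `eᵢ`, `fᵢ`, `hᵢ` for `i = 0, 1, …, r`. -/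
inductive Chev (r : ℕ) : Type
  | e (i : Fin (r + 1))
  | f (i : Fin (r + 1))
  | h (i : Fin (r + 1))

/-- The degree in the consistent `ℤ`-grading: `e₀` and `f₀` have degree `1` and `-1`, all other
generators have degree `0`. Thus `e₀` and `f₀` are odd and all other generators are even. -/
def Chev.consistent {r : ℕ} : Chev r → ℤ
  | .e i => if i = 0 then 1 else 0
  | .f i => if i = 0 then -1 else 0
  | .h _ => 0

/-- The degree in the `ℤ`-grading where all `eᵢ` and `fᵢ` have degree `1` and `-1`. -/
def Chev.democratic {r : ℕ} : Chev r → ℤ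
  | .e _ => 1
  | .f _ => -1
  | .h _ => 0

namespace Triple

variable {𝕂 : Type u} [Field 𝕂] {r : ℕ} (T : Triple 𝕂 r)

/-- The extended Cartan matrix. -/
def B : Matrix (Fin (r + 1)) (Fin (r + 1)) 𝕂 := extMatrix T.A T.ε T.lam

/-- A Chevalley generator as an element of the free algebra. -/
noncomputable def chev (𝕂 : Type u) [Field 𝕂] {r : ℕ} (x : Chev r) :
    FreeNonUnitalNonAssocAlgebra 𝕂 (Chev r) :=
  mono 𝕂 (FreeMagma.of x)

/-- The Chevalley relations. -/
inductive ChevRel : FreeNonUnitalNonAssocAlgebra 𝕂 (Chev r) → Prop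
  | he (i j) : ChevRel (chev 𝕂 (.h i) * chev 𝕂 (.e j) - T.B i j • chev 𝕂 (.e j))
  | hf (i j) : ChevRel (chev 𝕂 (.h i) * chev 𝕂 (.f j) + T.B i j • chev 𝕂 (.f j))
  | ef_same (i) : ChevRel (chev 𝕂 (.e i) * chev 𝕂 (.f i) - chev 𝕂 (.h i))
  | ef_ne (i j) (hij : i ≠ j) : ChevRel (chev 𝕂 (.e i) * chev 𝕂 (.f j))

/-- Generators and relations of `ℬ`. The ideal that is factored out in `T.pres.Alg` is the maximal
one that is graded with respect to the democratic grading and intersects the local part of that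
grading trivially, so `T.pres.Alg` is the contragredient Lie superalgebra `ℬ`. -/
noncomputable def pres : Pres 𝕂 (Chev r) where
  par := Chev.consistent
  deg := Chev.democratic
  rel := {x | T.ChevRel x}

/-- The contragredient Lie superalgebra `ℬ`. -/
abbrev Ctg : Type u := T.pres.Alg

/-- The component `ℬₖ` of the consistent `ℤ`-grading. -/
noncomputable abbrev comp (k : ℤ) : Submodule 𝕂 T.Ctg := T.pres.gr k

/-- The generator `f₀`, as an element of `ℬ₋₁`. -/
noncomputable def f₀ : T.comp (-1) := ⟨T.pres.gen (.f 0), T.pres.gen_mem (.f 0)⟩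

/-- The generators `hᵢ` for `i = 0, 1, …, r`, as elements of `ℬ₀`. -/
noncomputable def h (i : Fin (r + 1)) : T.comp 0 := ⟨T.pres.gen (.h i), T.pres.gen_mem (.h i)⟩

/-- The generators `eᵢ` of `𝔤` for `i = 1, …, r`, as elements of `ℬ₀`. -/
noncomputable def e (i : Fin r) : T.comp 0 := ⟨T.pres.gen (.e i.succ), by
  have h0 : T.pres.par (.e i.succ) = 0 := by
    change (if i.succ = 0 then (1 : ℤ) else 0) = 0
    rw [if_neg (Fin.succ_ne_zero i)]
  have h1 := T.pres.gen_mem (.e i.succ)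
  rw [h0] at h1
  exact h1⟩

/-- The generators `fᵢ` of `𝔤` for `i = 1, …, r`, as elements of `ℬ₀`. -/
noncomputable def f (i : Fin r) : T.comp 0 := ⟨T.pres.gen (.f i.succ), by
  have h0 : T.pres.par (.f i.succ) = 0 := by
    change (if i.succ = 0 then (-1 : ℤ) else 0) = 0
    rw [if_neg (Fin.succ_ne_zero i)]
  have h1 := T.pres.gen_mem (.f i.succ)
  rw [h0] at h1
  exact h1⟩

/-- The grading element `L = ∑ (B⁻¹)₀ᵢ hᵢ`. -/
noncomputable def L : T.comp 0 := ∑ i, T.B⁻¹ 0 i • T.h i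

/-- `Φ` is the extension of `κ` to an invariant bilinear form on `ℬ` with `ℤ₂`-graded symmetry,
normalised by `⟨e₀|f₀⟩ = 1` and `⟨eᵢ|fᵢ⟩ = κ(eᵢ, fᵢ) = εᵢ`. -/
structure IsStandardForm (Φ : T.Ctg →ₗ[𝕂] T.Ctg →ₗ[𝕂] 𝕂) : Prop where
  invariant : ∀ x y z, Φ (T.pres.br x y) z = Φ x (T.pres.br y z)
  symm : ∀ k l, ∀ x ∈ T.comp k, ∀ y ∈ T.comp l,
    Φ x y = (((k * l).negOnePow : ℤˣ) : ℤ) • Φ y x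
  ef_same : ∀ i, Φ (T.pres.gen (.e i)) (T.pres.gen (.f i)) =
    Fin.cases (motive := fun _ => 𝕂) 1 T.ε i
  ef_ne : ∀ i j, i ≠ j → Φ (T.pres.gen (.e i)) (T.pres.gen (.f j)) = 0

section

variable [CharZero 𝕂]

/-- The Kac–Moody algebra `𝔤`, as the subalgebra of `ℬ₀` generated by `eᵢ`, `fᵢ`, `hᵢ`
for `i = 1, …, r`. -/
noncomputable def g : LieSubalgebra 𝕂 (T.comp 0) :=
  LieSubalgebra.lieSpan 𝕂 (T.comp 0)
    (Set.range T.e ∪ Set.range T.f ∪ Set.range fun i : Fin r => T.h i.succ)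

/-- `x ∈ 𝔤` has weight `μ`. Weights of `𝔤` are elements `μ = ∑ μᵢ Λᵢ` of the dual of the Cartan
subalgebra, given by their Dynkin labels `μᵢ = μ(hᵢ)`. -/
def HasWeight (μ : Fin r → 𝕂) (x : T.comp 0) : Prop :=
  x ∈ T.g ∧ ∀ i : Fin r, ⁅T.h i.succ, x⁆ = μ i • x

/-- The roots of `𝔤`: the nonzero weights of the adjoint representation. -/
def IsRoot (μ : Fin r → 𝕂) : Prop :=
  μ ≠ 0 ∧ ∃ x, x ≠ 0 ∧ T.HasWeight μ x

end

/-- The matrix `κ(hᵢ, hⱼ) = κ([eᵢ, fᵢ], hⱼ) = κ(eᵢ, [fᵢ, hⱼ]) = Aⱼᵢ εᵢ` of `κ` on the Cartan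
subalgebra of `𝔤`. -/
def gram : Matrix (Fin r) (Fin r) 𝕂 := Matrix.of fun i j => (T.A j i : 𝕂) * T.ε i

/-- The bilinear form `(μ, ν) = κ(φ⁻¹(μ), φ⁻¹(ν))` on weights, where
`φ(hᵢ)(hⱼ) = κ(hᵢ, hⱼ)`. -/
noncomputable def pairing (μ ν : Fin r → 𝕂) : 𝕂 := μ ⬝ᵥ (T.gram⁻¹.mulVec ν)

/-- The weight with Dynkin labels `λᵢ`. -/
def weight : Fin r → 𝕂 := fun i => T.lam i

/-- The weight `λ^▲` with Dynkin labels `λᵢ / εᵢ`. -/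
noncomputable def weightUp : Fin r → 𝕂 := fun i => (T.ε i)⁻¹ * T.weight i

/-- The weight `μ` is pseudo-minuscule: it is dominant integral, and the weight `μ^▼` with Dynkin
labels `εᵢ μᵢ` satisfies `(μ^▼, α) ∈ {0, 1, -1}` for all roots `α` of `𝔤`, which means
`(μ^▼, α) ∈ {0, 1}` for all positive roots `α`. -/
def IsPseudoMinuscule [CharZero 𝕂] (μ : Fin r → 𝕂) : Prop :=
  (∃ n : Fin r → ℕ, ∀ i, μ i = n i) ∧
    ∀ α, T.IsRoot α → T.pairing (fun i => T.ε i * μ i) α = 0 ∨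
      T.pairing (fun i => T.ε i * μ i) α = 1 ∨ T.pairing (fun i => T.ε i * μ i) α = -1

/-- The local part of `ℬ` as a contragredient local Lie superalgebra, with the bilinear map
`ℬ₋₁ × ℬ₁ → 𝕂` induced by `Φ`. -/
noncomputable def contra [CharZero 𝕂] (Φ : T.Ctg →ₗ[𝕂] T.Ctg →ₗ[𝕂] 𝕂) :
    ContraData 𝕂 (T.comp (-1)) (T.comp 0) (T.comp 1) where
  pn := T.pres.grBr (add_neg_cancel 1)
  form := Φ.domRestrict₁₂ (T.comp (-1)) (T.comp 1)
  L := T.L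

end Triple

end Triples

end Cartanify

/-! Write ℬ₋₁, ℬ₀, ℬ₁ for the local part of ℬ. In the supercommutator of y ∈ ℬ₁ with a product x w
(x ∈ ℬ₋₁, w ∈ ℬ₀), the quadratic terms combine into commutators, because the products are
equivariant and L is central in ℬ₀. What remains is the element `pairBr` of ℬ₀: -⟦⟦w, y⟧, x⟧ - ⟨x|y⟩
w + ⟨x|⟦w, y⟧⟩ L. Hence the generated subalgebra lies in ℬ₋₁ℬ₀ ⊕ ℬ₀ ⊕ ℬ₁. Its elements of degree -1
that are killed by ℬ₁ form a peripheral ideal, so x w vanishes in the local cartanification as soon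
as `pairBr` vanishes for every y (`prodLocal_eq_zero`).

Take x = f₀. A triangular decomposition of ℬ shows that ℬ₁ is spanned by e₀ and the elements y
obtained from e₀ by acting with the e_j, j ≥ 1 (`comp_one_le`). The case y = e₀ is a direct
computation. Every other such y satisfies ⟨f₀|y⟩ = 0, and ⟦y, f₀⟧ is a weight vector of 𝔤. On 𝔤 the
element h₀ acts on weight β as -(λ, β), so pseudo-minuscularity only allows the h₀-eigenvalues 0, 1,
-1 on nonzero weight vectors. Integrality of λ^▲ makes the eigenvalue on ⟦y, f₀⟧ non-positive, and
eigenvalue 0 forces ⟦y, f₀⟧ = 0. Therefore h₀ acts on ⟦y, f₀⟧ as -1 (`IsRaised.br_h_zero`).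

For w = h₀ + L, the operators h₀ and L then contribute opposite terms. For w = e_β with (λ, β) = 1,
comparing h₀-eigenvalues gives ⟦e_β, f₀⟧ = 0 (`br_f_zero_eq_zero`), so only ⟦e_β, ⟦y, f₀⟧⟧ has to be
examined. It would be a vector of 𝔤 with h₀-eigenvalue -2, hence is zero. -/

namespace Cartanify

universe u v

attribute [local instance] LieRing.ofAssociativeRing

/-! ### Explicit products in M U(𝔤) -/

section Actions

variable {𝕂 : Type u} [Field 𝕂] {𝔤 M : Type v} [LieRing 𝔤] [LieAlgebra 𝕂 𝔤]
  [AddCommGroup M] [Module 𝕂 M]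

theorem mulMU_tmul (x : M) (u v : UniversalEnvelopingAlgebra 𝕂 𝔤) :
    mulMU 𝕂 𝔤 M u (x ⊗ₜ[𝕂] v) = x ⊗ₜ[𝕂] (v * u) := by
  simp [mulMU]

variable [LieRingModule 𝔤 M] [LieModule 𝕂 𝔤 M]

local notation "ι" => UniversalEnvelopingAlgebra.ι 𝕂

theorem toLeft_tmul_one (x : M) :
    toLeft 𝕂 𝔤 M (x ⊗ₜ[𝕂] (1 : UniversalEnvelopingAlgebra 𝕂 𝔤)) = 1 ⊗ₜ[𝕂] x := by
  simp [toLeft]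

theorem toLeft_tmul_ι (x : M) (w : 𝔤) :
    toLeft 𝕂 𝔤 M (x ⊗ₜ[𝕂] ι w) = ι w ⊗ₜ[𝕂] x - 1 ⊗ₜ[𝕂] ⁅w, x⁆ := by
  simp [toLeft, rightMul]

theorem mulUM_ι (a : 𝔤) (x : M) (v : UniversalEnvelopingAlgebra 𝕂 𝔤) :
    mulUM 𝕂 𝔤 M (ι a) (x ⊗ₜ[𝕂] v) = ⁅a, x⁆ ⊗ₜ[𝕂] v + x ⊗ₜ[𝕂] (ι a * v) := by
  simp [mulUM, leftMul]

end Actions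

/-! ### The vanishing criterion in the local cartanification -/

namespace ContraData

variable {𝕂 : Type u} [Field 𝕂] {N 𝔤 P : Type v} [LieRing 𝔤] [LieAlgebra 𝕂 𝔤]
  [AddCommGroup N] [Module 𝕂 N] [LieRingModule 𝔤 N]
  [AddCommGroup P] [Module 𝕂 P] [LieRingModule 𝔤 P]

local notation "ι" => UniversalEnvelopingAlgebra.ι 𝕂

/-- The bracket and the form are `𝔤`-equivariant, and `L` is central in `𝔤`. -/
structure IsEquivariant (G : ContraData 𝕂 N 𝔤 P) : Prop where
  L_lie : ∀ w : 𝔤, ⁅G.L, w⁆ = 0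
  lie_pn : ∀ (w : 𝔤) (y : P) (x : N), ⁅w, G.pn y x⁆ = G.pn ⁅w, y⁆ x + G.pn y ⁅w, x⁆
  form_lie : ∀ (w : 𝔤) (x : N) (y : P), G.form ⁅w, x⁆ y = -G.form x ⁅w, y⁆

variable {G : ContraData 𝕂 N 𝔤 P}

/-- The element `⟦y, x w⟧` of `𝔤`. -/
def pairBr (G : ContraData 𝕂 N 𝔤 P) (y : P) (x : N) (w : 𝔤) : 𝔤 :=
  -G.pn ⁅w, y⁆ x - G.form x y • w + G.form x ⁅w, y⁆ • G.L

/-- This is the Jacobi identity for a, y and x w; it makes the annihilator of P stable under 𝔤. -/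
theorem pairBr_equivariant (hG : G.IsEquivariant) (a : 𝔤) (y : P) (x : N) (w : 𝔤) :
    G.pairBr y ⁅a, x⁆ w + G.pairBr y x ⁅a, w⁆ = ⁅a, G.pairBr y x w⁆ - G.pairBr ⁅a, y⁆ x w := by
  have hL : ⁅a, G.L⁆ = 0 := by rw [← lie_skew, hG.L_lie, neg_zero]
  have h1 : ⁅⁅a, w⁆, y⁆ = ⁅a, ⁅w, y⁆⁆ - ⁅w, ⁅a, y⁆⁆ := lie_lie a w y
  simp only [pairBr, lie_add, lie_sub, lie_neg, lie_smul, hL, hG.lie_pn, hG.form_lie, h1, map_sub,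
    LinearMap.sub_apply, smul_zero, sub_smul, neg_smul]
  abel

variable [LieModule 𝕂 𝔤 N] [LieModule 𝕂 𝔤 P]

/-- The terms L w and w L cancel since L is central, and the products of w with ⟦y, x⟧ form a
commutator, expanded by equivariance. The constant 1 in the product x₁ y₋₁ yields the term ⟨x|y⟩ w.
-/
theorem commutatorLocal_pn (hG : G.IsEquivariant) (y : P) (x : N) (w : 𝔤) :
    G.commutatorLocal.pn (y ⊗ₜ[𝕂] 1) (x ⊗ₜ[𝕂] ι w) = ι (G.pairBr y x w) := by
  have h1 : ι ⁅w, G.pn y x⁆ = ι w * ι (G.pn y x) - ι (G.pn y x) * ι w := by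
    rw [LieHom.map_lie, LieRing.of_associative_ring_bracket]
  have h2 : ι G.L * ι w = ι w * ι G.L := by
    rw [← sub_eq_zero, ← LieRing.of_associative_ring_bracket, ← LieHom.map_lie, hG.L_lie, map_zero]
  have h3 : ι (G.pn y x) * ι w =
      ι w * ι (G.pn y x) - (ι (G.pn ⁅w, y⁆ x) + ι (G.pn y ⁅w, x⁆)) := by
    rw [← map_add, ← hG.lie_pn, h1]
    abel
  simp only [commutatorLocal, LinearMap.add_apply, LinearMap.comp_apply, LinearMap.flip_apply,
    toLeft_tmul_one, toLeft_tmul_ι, map_sub, LinearMap.sub_apply, extend_tmul, mulPN, mulNP,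
    pairBr]
  simp only [LinearMap.compr₂_apply, LinearMap.neg_apply, LinearMap.flip_apply,
    LinearMap.toSpanSingleton_apply, LieHom.coe_toLinearMap, hG.form_lie, map_neg, map_add,
    map_sub, map_smul, mul_one, one_mul, add_mul, mul_add, neg_mul, smul_mul_assoc,
    mul_smul_comm, smul_add, h2, h3, mul_neg]
  abel

theorem commutatorLocal_zn (a : 𝔤) (x : N) (w : 𝔤) :
    G.commutatorLocal.zn (ι a) (x ⊗ₜ[𝕂] ι w) = ⁅a, x⁆ ⊗ₜ[𝕂] ι w + x ⊗ₜ[𝕂] ι ⁅a, w⁆ := by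
  simp only [commutatorLocal, LinearMap.sub_apply, mulUM_ι, mulMU_tmul, LieHom.map_lie,
    LieRing.of_associative_ring_bracket, TensorProduct.tmul_sub]
  abel

theorem commutatorLocal_zp (a : 𝔤) (y : P) :
    G.commutatorLocal.zp (ι a) (y ⊗ₜ[𝕂] 1) = ⁅a, y⁆ ⊗ₜ[𝕂] 1 := by
  simp only [commutatorLocal, LinearMap.sub_apply, mulUM_ι, mulMU_tmul, one_mul, mul_one]
  abel

theorem commutatorLocal_zz (a b : 𝔤) : G.commutatorLocal.zz (ι a) (ι b) = ι ⁅a, b⁆ := by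
  simp [commutatorLocal, LieRing.of_associative_ring_bracket]

/-- `N 𝔤 ⊕ 𝔤 ⊕ P` is a subalgebra of the local Lie superalgebra. -/
theorem isSubalgebra_span (hG : G.IsEquivariant) :
    G.commutatorLocal.IsSubalgebra (Submodule.span 𝕂 G.prodsNZ)
      (LinearMap.range (ι : 𝔤 →ₗ⁅𝕂⁆ _).toLinearMap) (Submodule.span 𝕂 G.eltsP) where
  zz := by
    rintro _ ⟨a, rfl⟩ _ ⟨b, rfl⟩
    exact ⟨⁅a, b⁆, (commutatorLocal_zz a b).symm⟩
  zn := by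
    rintro _ ⟨a, rfl⟩ b hb
    induction hb using Submodule.span_induction with
    | mem b hb =>
      obtain ⟨x, w, rfl⟩ := hb
      rw [LieHom.coe_toLinearMap, commutatorLocal_zn]
      exact add_mem (Submodule.subset_span ⟨_, _, rfl⟩) (Submodule.subset_span ⟨_, _, rfl⟩)
    | zero => rw [map_zero]; exact zero_mem _
    | add b c _ _ h1 h2 => rw [map_add]; exact add_mem h1 h2
    | smul c b _ h1 => rw [map_smul]; exact Submodule.smul_mem _ c h1
  zp := by
    rintro _ ⟨a, rfl⟩ b hb
    induction hb using Submodule.span_induction with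
    | mem b hb =>
      obtain ⟨y, rfl⟩ := hb
      rw [LieHom.coe_toLinearMap, commutatorLocal_zp]
      exact Submodule.subset_span ⟨_, rfl⟩
    | zero => rw [map_zero]; exact zero_mem _
    | add b c _ _ h1 h2 => rw [map_add]; exact add_mem h1 h2
    | smul c b _ h1 => rw [map_smul]; exact Submodule.smul_mem _ c h1
  pn := by
    intro p hp b hb
    induction hp using Submodule.span_induction with
    | mem p hp =>
      obtain ⟨y, rfl⟩ := hp
      induction hb using Submodule.span_induction with
      | mem b hb =>
        obtain ⟨x, w, rfl⟩ := hb
        rw [commutatorLocal_pn hG]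
        exact ⟨_, rfl⟩
      | zero => rw [map_zero]; exact zero_mem _
      | add b c _ _ h1 h2 => rw [map_add]; exact add_mem h1 h2
      | smul c b _ h1 => rw [map_smul]; exact Submodule.smul_mem _ c h1
    | zero => rw [map_zero, LinearMap.zero_apply]; exact zero_mem _
    | add b c _ _ h1 h2 => rw [map_add, LinearMap.add_apply]; exact add_mem h1 h2
    | smul c b _ h1 => rw [map_smul, LinearMap.smul_apply]; exact Submodule.smul_mem _ c h1

theorem genN_le (hG : G.IsEquivariant) :
    G.commutatorLocal.genN G.prodsNZ G.eltsP ≤ Submodule.span 𝕂 G.prodsNZ :=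
  sInf_le ⟨_, _, isSubalgebra_span hG, Submodule.subset_span, Submodule.subset_span⟩

theorem genZ_le (hG : G.IsEquivariant) :
    G.commutatorLocal.genZ G.prodsNZ G.eltsP ≤ LinearMap.range (ι : 𝔤 →ₗ⁅𝕂⁆ _).toLinearMap :=
  sInf_le ⟨_, _, isSubalgebra_span hG, Submodule.subset_span, Submodule.subset_span⟩

theorem genP_le (hG : G.IsEquivariant) :
    G.commutatorLocal.genP G.prodsNZ G.eltsP ≤ Submodule.span 𝕂 G.eltsP :=
  sInf_le ⟨_, _, isSubalgebra_span hG, Submodule.subset_span, Submodule.subset_span⟩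

theorem commutatorLocal_pn_zn (hG : G.IsEquivariant) (a : 𝔤) (y : P) {b : N ⊗[𝕂] _}
    (hb : b ∈ Submodule.span 𝕂 G.prodsNZ) :
    G.commutatorLocal.pn (y ⊗ₜ[𝕂] 1) (G.commutatorLocal.zn (ι a) b) =
      G.commutatorLocal.zz (ι a) (G.commutatorLocal.pn (y ⊗ₜ[𝕂] 1) b) -
        G.commutatorLocal.pn (⁅a, y⁆ ⊗ₜ[𝕂] 1) b := by
  induction hb using Submodule.span_induction with
  | mem b hb =>
    obtain ⟨x, w, rfl⟩ := hb
    rw [commutatorLocal_zn, map_add, commutatorLocal_pn hG, commutatorLocal_pn hG,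
      commutatorLocal_pn hG, commutatorLocal_pn hG, commutatorLocal_zz, ← map_add, ← map_sub,
      pairBr_equivariant hG]
  | zero => simp
  | add b c _ _ h1 h2 =>
    simp only [map_add, h1, h2]
    abel
  | smul c b _ h1 => simp only [map_smul, h1, smul_sub]

/-- The elements of degree `-1` that are annihilated by `P`. -/
noncomputable def annN (G : ContraData 𝕂 N 𝔤 P) :
    Submodule 𝕂 (G.commutatorLocal.genN G.prodsNZ G.eltsP) where
  carrier := {b | ∀ y : P, G.commutatorLocal.pn (y ⊗ₜ[𝕂] 1) b = 0}
  add_mem' ha hb y := by rw [Submodule.coe_add, map_add, ha y, hb y, add_zero]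
  zero_mem' y := by rw [Submodule.coe_zero, map_zero]
  smul_mem' c b hb y := by rw [Submodule.coe_smul, map_smul, hb y, smul_zero]

/-- Testing against y ⊗ 1 suffices because the generated component of degree 1 is no larger than P;
likewise only the action of 𝔤, not of all of U(𝔤), has to be checked in degree 0. -/
theorem annN_isPeripheral (hG : G.IsEquivariant) : G.subLocal.IsPeripheral G.annN ⊥ where
  zn := by
    intro a b hb y
    obtain ⟨a', ha'⟩ := genZ_le hG a.2
    change G.commutatorLocal.pn (y ⊗ₜ[𝕂] 1) (G.commutatorLocal.zn (a : _) (b : _)) = 0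
    rw [← ha', LieHom.coe_toLinearMap, commutatorLocal_pn_zn hG a' y (genN_le hG b.2), hb, hb,
      map_zero, sub_zero]
  zp := by
    intro a b hb
    rw [Submodule.mem_bot] at hb ⊢
    rw [hb, map_zero]
  pn := by
    intro p b hb
    apply Subtype.ext
    obtain ⟨p, hp⟩ := p
    have hp' := genP_le hG hp
    change G.commutatorLocal.pn p (b : _) = 0
    clear hp
    induction hp' using Submodule.span_induction with
    | mem p hp => obtain ⟨y, rfl⟩ := hp; exact hb y
    | zero => rw [map_zero, LinearMap.zero_apply]
    | add p q _ _ h1 h2 => rw [map_add, LinearMap.add_apply, h1, h2, add_zero]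
    | smul c p _ h1 => rw [map_smul, LinearMap.smul_apply, h1, smul_zero]
  pn' := by
    intro a ha b
    rw [Submodule.mem_bot] at ha
    rw [ha, map_zero, LinearMap.zero_apply]

theorem prodLocal_eq_zero (hG : G.IsEquivariant) {x : N} {w : 𝔤}
    (h : ∀ y, G.pairBr y x w = 0) : G.prodLocal x w = 0 := by
  have hle : G.annN ≤ G.subLocal.maxN := le_sSup ⟨⊥, annN_isPeripheral hG⟩
  refine (Submodule.Quotient.mk_eq_zero _).2 (hle fun y => ?_)
  rw [commutatorLocal_pn hG, h, map_zero]

theorem prod_eq_zero {x : N} {w : 𝔤} (h : G.prodLocal x w = 0) : G.prod x w = 0 := by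
  -- Linearity of the generators is itself imposed by relations; the scalar 0 shows that the
  -- generator attached to the zero element vanishes.
  have h1 := G.localCart.minimal.allRel_mem
    (.rel _ (LocalBr.GlobalRel.neg_smul 0 (G.prodLocal x w)))
  rw [zero_smul, zero_smul, sub_zero] at h1
  rw [prod, h]
  exact (Submodule.Quotient.mk_eq_zero _).2 h1

end ContraData

/-! ### Triangular decomposition from generators and relations -/

namespace Pres

variable {𝕂 : Type u} [Field 𝕂] {X : Type v} (P : Pres 𝕂 X)

theorem span_mono :
    Submodule.span 𝕂 (Set.range fun a : FreeMagma X => P.maxIdeal.mkQ (mono 𝕂 a)) = ⊤ := by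
  rw [eq_top_iff]
  intro z _
  obtain ⟨z, rfl⟩ := P.maxIdeal.mkQ_surjective z
  induction z using MonoidAlgebra.induction_linear with
  | zero => rw [map_zero]; exact zero_mem _
  | add f g hf hg => rw [map_add]; exact add_mem (hf trivial) (hg trivial)
  | single a c =>
    have h : (MonoidAlgebra.single a c : MonoidAlgebra 𝕂 (FreeMagma X)) = c • mono 𝕂 a := by
      simp [mono]
    erw [h, map_smul]
    exact Submodule.smul_mem _ c (Submodule.subset_span ⟨a, rfl⟩)

theorem mkQ_mono_mem (a : FreeMagma X) : P.maxIdeal.mkQ (mono 𝕂 a) ∈ P.gr (wordDeg P.par a) :=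
  Submodule.subset_span ⟨a, rfl, rfl⟩

/-- The sign depends only on the first two arguments, so the third need not be homogeneous. -/
theorem br_br {k l : ℤ} {x y : P.Alg} (hx : x ∈ P.gr k) (hy : y ∈ P.gr l) (z : P.Alg) :
    P.br x (P.br y z) =
      P.br (P.br x y) z + (((k * l).negOnePow : ℤˣ) : ℤ) • P.br y (P.br x z) := by
  have hz : z ∈ (⊤ : Submodule 𝕂 P.Alg) := trivial
  rw [← P.span_mono] at hz
  induction hz using Submodule.span_induction with
  | mem z hz =>
    obtain ⟨a, rfl⟩ := hz
    have h := P.br_jacobi hx hy (P.mkQ_mono_mem a)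
    rwa [sub_sub, sub_eq_zero] at h
  | zero => simp
  | add y z _ _ h1 h2 => simp only [map_add, smul_add, h1, h2]; abel
  | smul c y _ h1 => simp only [map_smul, h1, smul_add]; rw [smul_comm c]

theorem br_br_zero {l : ℤ} {x y : P.Alg} (hx : x ∈ P.gr 0) (hy : y ∈ P.gr l) (z : P.Alg) :
    P.br x (P.br y z) = P.br (P.br x y) z + P.br y (P.br x z) := by
  have h := P.br_br hx hy z
  rwa [zero_mul, Int.negOnePow_zero, Units.val_one, one_smul] at h

theorem br_comm {k : ℤ} {x y : P.Alg} (hx : x ∈ P.gr 0) (hy : y ∈ P.gr k) :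
    P.br x y = -P.br y x := by
  have h := P.br_antisymm hx hy
  rw [zero_mul, Int.negOnePow_zero, Units.val_one, one_smul] at h
  exact eq_neg_of_add_eq_zero_left h

section Words

variable {σ : Type*} (d : σ → ℤ) (x y h : σ → P.Alg)

/-- Right-normed brackets of the elements `x i`, where `x i` has degree `d i`. -/
inductive IsWord : ℤ → P.Alg → Prop
  | of (i) (k : ℤ) (hk : k = d i) : IsWord k (x i)
  | br (i) (k l : ℤ) (w : P.Alg) (hw : IsWord l w) (hk : k = d i + l) : IsWord k (P.br (x i) w)

/-- The span of the right-normed brackets of degree `k`. -/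
noncomputable def words (k : ℤ) : Submodule 𝕂 P.Alg := Submodule.span 𝕂 {w | P.IsWord d x k w}

/-- The span of the elements `h i`, put in degree `0`. -/
noncomputable def cartan (k : ℤ) : Submodule 𝕂 P.Alg :=
  Submodule.span 𝕂 {w | k = 0 ∧ w ∈ Set.range h}

/-- The elements `h i` act diagonally on the `x j`, and `⟦y i, x j⟧` vanishes if `i ≠ j` and is
proportional to `h i` otherwise. -/
structure IsHalf : Prop where
  x_mem : ∀ i, x i ∈ P.gr (d i)
  y_mem : ∀ i, y i ∈ P.gr (-d i)
  h_mem : ∀ i, h i ∈ P.gr 0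
  hx : ∀ i j, ∃ c : 𝕂, P.br (h i) (x j) = c • x j
  yx_same : ∀ i, ∃ c : 𝕂, P.br (y i) (x i) = c • h i
  yx_ne : ∀ i j, i ≠ j → P.br (y i) (x j) = 0

variable {P d x y h}

theorem IsHalf.br_h (H : P.IsHalf d x y h) (i : σ) {k : ℤ} {w : P.Alg}
    (hw : P.IsWord d x k w) : ∃ c : 𝕂, P.br (h i) w = c • w := by
  induction hw with
  | of j k hk => exact H.hx i j
  | br j k l w hw hk ih =>
    obtain ⟨c, hc⟩ := ih
    obtain ⟨c', hc'⟩ := H.hx i j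
    refine ⟨c' + c, ?_⟩
    rw [P.br_br_zero (H.h_mem i) (H.x_mem j), hc, hc', map_smul, map_smul, LinearMap.smul_apply,
      add_smul]

theorem IsHalf.br_h_mem (H : P.IsHalf d x y h) (i : σ) {k : ℤ} {w : P.Alg}
    (hw : w ∈ P.words d x k) : P.br (h i) w ∈ P.words d x k := by
  induction hw using Submodule.span_induction with
  | mem w hw =>
    obtain ⟨c, hc⟩ := H.br_h i hw
    rw [hc]
    exact Submodule.smul_mem _ c (Submodule.subset_span hw)
  | zero => rw [map_zero]; exact zero_mem _
  | add b c _ _ h1 h2 => rw [map_add]; exact add_mem h1 h2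
  | smul c b _ h1 => rw [map_smul]; exact Submodule.smul_mem _ c h1

theorem br_words_mem (i : σ) {k l : ℤ} (hk : k = d i + l) {w : P.Alg} (hw : w ∈ P.words d x l) :
    P.br (x i) w ∈ P.words d x k := by
  induction hw using Submodule.span_induction with
  | mem w hw => exact Submodule.subset_span (.br i k l w hw hk)
  | zero => rw [map_zero]; exact zero_mem _
  | add b c _ _ h1 h2 => rw [map_add]; exact add_mem h1 h2
  | smul c b _ h1 => rw [map_smul]; exact Submodule.smul_mem _ c h1

theorem IsHalf.br_cartan_mem (H : P.IsHalf d x y h) (i : σ) {k l : ℤ} (hk : k = d i + l)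
    {w : P.Alg} (hw : w ∈ P.cartan h l) : P.br (x i) w ∈ P.words d x k := by
  induction hw using Submodule.span_induction with
  | mem w hw =>
    obtain ⟨rfl, j, rfl⟩ := hw
    obtain ⟨c, hc⟩ := H.hx j i
    have h1 := P.br_comm (H.h_mem j) (H.x_mem i)
    rw [hc] at h1
    rw [← neg_eq_iff_eq_neg.2 h1, ← neg_smul]
    exact Submodule.smul_mem _ _ (Submodule.subset_span (.of i k (by rw [hk, add_zero])))
  | zero => rw [map_zero]; exact zero_mem _
  | add b c _ _ h1 h2 => rw [map_add]; exact add_mem h1 h2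
  | smul c b _ h1 => rw [map_smul]; exact Submodule.smul_mem _ c h1

/-- By the Jacobi identity `y i` moves inwards through the word. Meeting `x i` it leaves a multiple
of `h i`, which acts diagonally on the remaining word; the Cartan part only survives when nothing
remains. -/
theorem IsHalf.br_y_mem (H : P.IsHalf d x y h) (i : σ) {k l : ℤ} (hk : k = -d i + l)
    {w : P.Alg} (hw : w ∈ P.words d x l) :
    P.br (y i) w ∈ P.words d x k ⊔ P.cartan h k := by
  induction hw using Submodule.span_induction with
  | mem w hw =>
    change P.IsWord d x l w at hw
    induction hw generalizing k with
    | of j l hl =>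
      by_cases hij : i = j
      · subst hij
        obtain ⟨c, hc⟩ := H.yx_same i
        rw [hc]
        exact Submodule.mem_sup_right (Submodule.smul_mem _ c
          (Submodule.subset_span ⟨by rw [hk, hl, neg_add_cancel], i, rfl⟩))
      · rw [H.yx_ne i j hij]
        exact zero_mem _
    | br j l m w hw hl ih =>
      rw [P.br_br (H.y_mem i) (H.x_mem j)]
      refine add_mem ?_ (zsmul_mem ?_ _)
      · by_cases hij : i = j
        · subst hij
          obtain ⟨c, hc⟩ := H.yx_same i
          rw [hc, map_smul, LinearMap.smul_apply]
          have hkm : k = m := by rw [hk, hl, neg_add_cancel_left]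
          subst hkm
          exact Submodule.mem_sup_left (Submodule.smul_mem _ c
            (H.br_h_mem i (Submodule.subset_span hw)))
        · rw [H.yx_ne i j hij, map_zero, LinearMap.zero_apply]
          exact zero_mem _
      · obtain ⟨u, hu, v, hv, huv⟩ := Submodule.mem_sup.1 (ih rfl)
        have hkj : k = d j + (-d i + m) := by rw [hk, hl]; ring
        rw [← huv, map_add]
        exact Submodule.mem_sup_left (add_mem (br_words_mem j hkj hu) (H.br_cartan_mem j hkj hv))
  | zero => rw [map_zero]; exact zero_mem _
  | add b c _ _ h1 h2 => rw [map_add]; exact add_mem h1 h2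
  | smul c b _ h1 => rw [map_smul]; exact Submodule.smul_mem _ c h1

variable (P d x y h) in
/-- The candidate for the component of degree `k` in a triangular decomposition. -/
noncomputable def triangular (k : ℤ) : Submodule 𝕂 P.Alg :=
  P.words d x k ⊔ P.cartan h k ⊔ P.words (fun i => -d i) y k

theorem IsHalf.br_x_triangular (H : P.IsHalf d x y h) (H' : P.IsHalf (fun i => -d i) y x h)
    (i : σ) {k l : ℤ} (hk : k = d i + l) {w : P.Alg} (hw : w ∈ P.triangular d x y h l) :
    P.br (x i) w ∈ P.triangular d x y h k := by
  obtain ⟨s, hs, v, hv, rfl⟩ := Submodule.mem_sup.1 hw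
  obtain ⟨u, hu, t, ht, rfl⟩ := Submodule.mem_sup.1 hs
  rw [map_add, map_add]
  refine add_mem (Submodule.mem_sup_left (Submodule.mem_sup_left
    (add_mem (br_words_mem i hk hu) (H.br_cartan_mem i hk ht)))) ?_
  obtain ⟨a, ha, b, hb, hab⟩ := Submodule.mem_sup.1
    (H'.br_y_mem i (k := k) (by rw [hk, neg_neg]) hv)
  rw [← hab]
  exact add_mem (Submodule.mem_sup_right ha) (Submodule.mem_sup_left (Submodule.mem_sup_right hb))

theorem triangular_swap (k : ℤ) :
    P.triangular (fun i => -d i) y x h k = P.triangular d x y h k := by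
  simp only [triangular, neg_neg]
  rw [sup_assoc, sup_comm, sup_comm (P.cartan h k)]

theorem IsHalf.br_h_triangular (H : P.IsHalf d x y h) (H' : P.IsHalf (fun i => -d i) y x h)
    (hh : ∀ i j, P.br (h i) (h j) = 0)
    (i : σ) {k : ℤ} {w : P.Alg} (hw : w ∈ P.triangular d x y h k) :
    P.br (h i) w ∈ P.triangular d x y h k := by
  obtain ⟨s, hs, v, hv, rfl⟩ := Submodule.mem_sup.1 hw
  obtain ⟨u, hu, t, ht, rfl⟩ := Submodule.mem_sup.1 hs
  have h0 : P.br (h i) t = 0 := by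
    clear hs hw
    induction ht using Submodule.span_induction with
    | mem w hw =>
      obtain ⟨-, j, rfl⟩ := hw
      exact hh i j
    | zero => rw [map_zero]
    | add b c _ _ h1 h2 => rw [map_add, h1, h2, add_zero]
    | smul c b _ h1 => rw [map_smul, h1, smul_zero]
  rw [map_add, map_add, h0, add_zero]
  exact add_mem (Submodule.mem_sup_left (Submodule.mem_sup_left (H.br_h_mem i hu)))
    (Submodule.mem_sup_right (H'.br_h_mem i hv))

/-- If every generator is one of the `x i`, `y i`, `h i`, the algebra is the sum of the spaces
spanned by the brackets of the `x i`, by the `h i`, and by the brackets of the `y i`. -/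
theorem IsHalf.gr_le_triangular (H : P.IsHalf d x y h) (H' : P.IsHalf (fun i => -d i) y x h)
    (hh : ∀ i j, P.br (h i) (h j) = 0)
    (hgen : ∀ g : X, (∃ i, P.gen g = x i ∧ P.par g = d i) ∨
      (∃ i, P.gen g = y i ∧ P.par g = -d i) ∨ ∃ i, P.gen g = h i ∧ P.par g = 0) (k : ℤ) :
    P.gr k ≤ P.triangular d x y h k := by
  -- The induction needs that bracketing with an arbitrary monomial preserves the triangular sum;
  -- the Jacobi identity reduces a product to its two factors.
  have key : ∀ (a : FreeMagma X) (k l : ℤ), k = wordDeg P.par a + l →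
      ∀ w ∈ P.triangular d x y h l,
        P.br (P.maxIdeal.mkQ (mono 𝕂 a)) w ∈ P.triangular d x y h k := by
    intro a
    induction a using FreeMagma.recOnMul with
    | ih1 g =>
      intro k l hk w hw
      change k = P.par g + l at hk
      change P.br (P.gen g) w ∈ _
      rcases hgen g with ⟨i, h1, h2⟩ | ⟨i, h1, h2⟩ | ⟨i, h1, h2⟩
      · rw [h1]
        exact H.br_x_triangular H' i (h2 ▸ hk) hw
      · rw [h1, ← triangular_swap]
        rw [← triangular_swap] at hw
        have H2 : P.IsHalf (fun i => - -d i) x y h := by simpa only [neg_neg] using H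
        exact H'.br_x_triangular H2 i (h2 ▸ hk) hw
      · rw [h1]
        rw [h2, zero_add] at hk
        exact hk ▸ H.br_h_triangular H' hh i hw
    | ih2 a b iha ihb =>
      intro k l hk w hw
      rw [wordDeg_mul] at hk
      have h1 := P.br_br (P.mkQ_mono_mem a) (P.mkQ_mono_mem b) w
      rw [← Pres.mono_mul, ← P.br_mkQ, ← sub_eq_iff_eq_add.2 h1]
      exact sub_mem (iha _ _ (by rw [hk]; ring) _ (ihb _ _ rfl _ hw))
        (zsmul_mem (ihb _ _ (by rw [hk]; ring) _ (iha _ _ rfl _ hw)) _)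
  refine Submodule.span_le.2 ?_
  rintro _ ⟨a, rfl, rfl⟩
  induction a using FreeMagma.recOnMul with
  | ih1 g =>
    change P.gen g ∈ P.triangular d x y h (P.par g)
    rcases hgen g with ⟨i, h1, h2⟩ | ⟨i, h1, h2⟩ | ⟨i, h1, h2⟩ <;> rw [h1]
    · exact Submodule.mem_sup_left (Submodule.mem_sup_left (Submodule.subset_span (.of i _ h2)))
    · exact Submodule.mem_sup_right (Submodule.subset_span (.of i _ h2))
    · exact Submodule.mem_sup_left (Submodule.mem_sup_right (Submodule.subset_span ⟨h2, i, rfl⟩))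
  | ih2 a b _ ihb =>
    rw [← Pres.mono_mul, ← P.br_mkQ]
    exact key a _ _ (wordDeg_mul _ _ _) _ ihb

end Words

end Pres

/-! ### The Chevalley generators of ℬ and its triangular decomposition -/

namespace Triple

variable {𝕂 : Type u} [Field 𝕂] {r : ℕ} (T : Triple 𝕂 r)

/-- The degree of `e i` in the consistent grading. -/
def deg (i : Fin (r + 1)) : ℤ := Chev.consistent (.e i)

theorem deg_zero : deg (0 : Fin (r + 1)) = 1 := rfl

theorem deg_succ (i : Fin r) : deg i.succ = 0 := by
  simp [deg, Chev.consistent, Fin.succ_ne_zero]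

theorem consistent_f (i : Fin (r + 1)) : Chev.consistent (.f i) = -deg i := by
  simp only [deg, Chev.consistent]
  split <;> rfl

theorem e_mem (i : Fin (r + 1)) : T.pres.gen (.e i) ∈ T.comp (deg i) := T.pres.gen_mem (.e i)

theorem f_mem (i : Fin (r + 1)) : T.pres.gen (.f i) ∈ T.comp (-deg i) := by
  rw [← consistent_f]
  exact T.pres.gen_mem (.f i)

theorem h_mem (i : Fin (r + 1)) : T.pres.gen (.h i) ∈ T.comp 0 := T.pres.gen_mem (.h i)

theorem e_succ_mem (i : Fin r) : T.pres.gen (.e i.succ) ∈ T.comp 0 := deg_succ i ▸ T.e_mem i.succ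

theorem mkQ_rel {x} (hx : T.ChevRel x) : T.pres.maxIdeal.mkQ x = 0 :=
  (Submodule.Quotient.mk_eq_zero _).2 (T.pres.allRel_mem (.rel x hx))

theorem br_h_e (i j) :
    T.pres.br (T.pres.gen (.h i)) (T.pres.gen (.e j)) = T.B i j • T.pres.gen (.e j) := by
  have h := T.mkQ_rel (.he i j)
  rwa [map_sub, map_smul, sub_eq_zero] at h

theorem br_h_f (i j) :
    T.pres.br (T.pres.gen (.h i)) (T.pres.gen (.f j)) = -T.B i j • T.pres.gen (.f j) := by
  have h := T.mkQ_rel (.hf i j)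
  rw [map_add, map_smul] at h
  rw [neg_smul]
  exact eq_neg_of_add_eq_zero_left h

theorem br_e_f_same (i) :
    T.pres.br (T.pres.gen (.e i)) (T.pres.gen (.f i)) = T.pres.gen (.h i) := by
  have h := T.mkQ_rel (.ef_same i)
  rwa [map_sub, sub_eq_zero] at h

theorem br_e_f_ne (i j) (hij : i ≠ j) :
    T.pres.br (T.pres.gen (.e i)) (T.pres.gen (.f j)) = 0 := T.mkQ_rel (.ef_ne i j hij)

theorem br_h_h (i j) : T.pres.br (T.pres.gen (.h i)) (T.pres.gen (.h j)) = 0 := by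
  rw [← T.br_e_f_same j, T.pres.br_br_zero (T.h_mem i) (T.e_mem j), T.br_h_e, T.br_h_f, map_smul,
    map_smul, LinearMap.smul_apply, neg_smul, add_neg_cancel]

theorem isHalf_e : T.pres.IsHalf deg (fun i => T.pres.gen (.e i)) (fun i => T.pres.gen (.f i))
    (fun i => T.pres.gen (.h i)) where
  x_mem := T.e_mem
  y_mem := T.f_mem
  h_mem := T.h_mem
  hx i j := ⟨_, T.br_h_e i j⟩
  yx_same i := by
    have h := T.pres.br_antisymm (T.f_mem i) (T.e_mem i)
    rw [T.br_e_f_same, ← Int.cast_smul_eq_zsmul 𝕂] at h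
    exact ⟨_, by rw [eq_neg_of_add_eq_zero_left h, ← neg_smul]⟩
  yx_ne i j hij := by
    have h := T.pres.br_antisymm (T.f_mem i) (T.e_mem j)
    rwa [T.br_e_f_ne j i hij.symm, smul_zero, add_zero] at h

theorem isHalf_f : T.pres.IsHalf (fun i => -deg i) (fun i => T.pres.gen (.f i))
    (fun i => T.pres.gen (.e i)) (fun i => T.pres.gen (.h i)) where
  x_mem := T.f_mem
  y_mem i := (neg_neg (deg i)).symm ▸ T.e_mem i
  h_mem := T.h_mem
  hx i j := ⟨_, T.br_h_f i j⟩
  yx_same i := ⟨1, by rw [one_smul, T.br_e_f_same]⟩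
  yx_ne i j hij := T.br_e_f_ne i j hij

theorem comp_le_triangular (k : ℤ) : T.comp k ≤ T.pres.triangular deg
    (fun i => T.pres.gen (.e i)) (fun i => T.pres.gen (.f i)) (fun i => T.pres.gen (.h i)) k := by
  refine T.isHalf_e.gr_le_triangular T.isHalf_f T.br_h_h ?_ k
  rintro (i | i | i)
  · exact .inl ⟨i, rfl, rfl⟩
  · exact .inr (.inl ⟨i, rfl, consistent_f i⟩)
  · exact .inr (.inr ⟨i, rfl, rfl⟩)

theorem br_h_zero_f_zero : T.pres.br (T.pres.gen (.h 0)) (T.pres.gen (.f 0)) = 0 := by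
  rw [T.br_h_f]
  simp [B, extMatrix]

theorem br_h_zero_e_zero : T.pres.br (T.pres.gen (.h 0)) (T.pres.gen (.e 0)) = 0 := by
  rw [T.br_h_e]
  simp [B, extMatrix]

theorem B_zero_succ (j : Fin r) : T.B 0 j.succ = -(T.lam j / T.ε j) := rfl

theorem B_succ_succ (i j : Fin r) : T.B i.succ j.succ = T.A i j := rfl

/-! ### The component of degree `1` -/

/-- `y` is obtained from `e₀` by acting `n j` times with `e j`, for `j = 1, …, r`. -/
inductive IsRaised : (Fin r → ℕ) → T.Ctg → Prop
  | zero : IsRaised 0 (T.pres.gen (.e 0))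
  | step (j : Fin r) (n : Fin r → ℕ) (y : T.Ctg) (hy : IsRaised n y) :
      IsRaised (n + Pi.single j 1) (T.pres.br (T.pres.gen (.e j.succ)) y)

variable {T} in
theorem IsRaised.mem {n : Fin r → ℕ} {y : T.Ctg} (hy : T.IsRaised n y) : y ∈ T.comp 1 := by
  induction hy with
  | zero => exact T.e_mem 0
  | step j n y _ ih => exact T.pres.br_mem (zero_add 1) (T.e_succ_mem j) ih

variable {T} in
theorem IsRaised.eq {n : Fin r → ℕ} {y : T.Ctg} (hy : T.IsRaised n y) (hn : n = 0) :
    y = T.pres.gen (.e 0) := by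
  cases hy with
  | zero => rfl
  | step j n y _ =>
    have h := congrFun hn j
    simp at h

theorem br_e_raised_mem (j : Fin r) {y : T.Ctg}
    (hy : y ∈ Submodule.span 𝕂 {y | ∃ n, T.IsRaised n y}) :
    T.pres.br (T.pres.gen (.e j.succ)) y ∈ Submodule.span 𝕂 {y | ∃ n, T.IsRaised n y} := by
  induction hy using Submodule.span_induction with
  | mem w hw =>
    obtain ⟨n, hw⟩ := hw
    exact Submodule.subset_span ⟨_, .step j n w hw⟩
  | zero => rw [map_zero]; exact zero_mem _
  | add b c _ _ h1 h2 => rw [map_add]; exact add_mem h1 h2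
  | smul c b _ h1 => rw [map_smul]; exact Submodule.smul_mem _ c h1

/-- The degree counts occurrences of e₀. Words of degree 0 use only e_j with j ≥ 1, so they commute
with f₀ and preserve the span of raised elements; in degree 1 there is a single e₀. The claims are
proved together because each feeds the induction for the others. -/
theorem isWord_e {k : ℤ} {w : T.Ctg}
    (hw : T.pres.IsWord deg (fun i => T.pres.gen (.e i)) k w) :
    0 ≤ k ∧ w ∈ T.comp k ∧ (k = 0 → T.pres.br w (T.pres.gen (.f 0)) = 0 ∧
      ∀ y ∈ Submodule.span 𝕂 {y | ∃ n, T.IsRaised n y},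
        T.pres.br w y ∈ Submodule.span 𝕂 {y | ∃ n, T.IsRaised n y}) ∧
      (k = 1 → w ∈ Submodule.span 𝕂 {y | ∃ n, T.IsRaised n y}) := by
  induction hw with
  | of i k hk =>
    subst hk
    induction i using Fin.cases with
    | zero =>
      exact ⟨zero_le_one, T.e_mem 0, fun h => absurd h one_ne_zero,
        fun _ => Submodule.subset_span ⟨0, .zero⟩⟩
    | succ j =>
      refine ⟨(deg_succ j).ge, T.e_mem _, fun _ => ⟨T.br_e_f_ne _ _ (Fin.succ_ne_zero j),
        fun y hy => T.br_e_raised_mem j hy⟩, fun h => ?_⟩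
      rw [deg_succ] at h
      exact absurd h zero_ne_one
  | br i k l w hw hk ih =>
    obtain ⟨h1, h2, h3, h4⟩ := ih
    refine ⟨?_, T.pres.br_mem hk.symm (T.e_mem i) h2, ?_⟩
    · induction i using Fin.cases with
      | zero => rw [deg_zero] at hk; lia
      | succ j => rw [deg_succ] at hk; lia
    induction i using Fin.cases with
    | zero =>
      rw [deg_zero] at hk
      refine ⟨fun h => by lia, fun h => ?_⟩
      obtain rfl : l = 0 := by lia
      -- When e₀ is outermost, antisymmetry turns the word into the degree 0 word w acting on e₀.
      have h5 := T.pres.br_comm h2 (T.e_mem 0)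
      rw [← neg_eq_iff_eq_neg.2 h5]
      exact neg_mem ((h3 rfl).2 _ (Submodule.subset_span ⟨0, .zero⟩))
    | succ j =>
      rw [deg_succ, zero_add] at hk
      subst hk
      refine ⟨fun h => ?_, fun h => T.br_e_raised_mem j (h4 h)⟩
      subst h
      have h5 := fun z => (sub_eq_iff_eq_add.2 (T.pres.br_br_zero (T.e_succ_mem j) h2 z)).symm
      refine ⟨?_, fun y hy => ?_⟩
      · rw [h5, (h3 rfl).1, T.br_e_f_ne _ _ (Fin.succ_ne_zero j), map_zero, map_zero, sub_zero]
      · rw [h5]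
        exact sub_mem (T.br_e_raised_mem j ((h3 rfl).2 y hy))
          ((h3 rfl).2 _ (T.br_e_raised_mem j hy))

theorem isWord_f_nonpos {k : ℤ} {w : T.Ctg}
    (hw : T.pres.IsWord (fun i => -deg i) (fun i => T.pres.gen (.f i)) k w) : k ≤ 0 := by
  have hd : ∀ i : Fin (r + 1), 0 ≤ deg i := by
    intro i
    simp only [deg, Chev.consistent]
    split <;> simp
  induction hw with
  | of i k hk => have := hd i; lia
  | br i k l w _ hk ih => have := hd i; lia

theorem comp_one_le : T.comp 1 ≤ Submodule.span 𝕂 {y | ∃ n, T.IsRaised n y} := by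
  refine (T.comp_le_triangular 1).trans (sup_le (sup_le ?_ ?_) ?_) <;> refine Submodule.span_le.2 ?_
  · exact fun w hw => (T.isWord_e hw).2.2.2 rfl
  · rintro w ⟨h, -⟩
    exact absurd h one_ne_zero
  · intro w hw
    exact absurd (T.isWord_f_nonpos hw) (by norm_num)

/-! ### The grading element -/

theorem coe_L : (T.L : T.Ctg) = ∑ i, T.B⁻¹ 0 i • T.pres.gen (.h i) := by
  simp [L, Triple.h]

theorem sum_B_inv (j : Fin (r + 1)) : ∑ i, T.B⁻¹ 0 i * T.B i j = (deg j : 𝕂) := by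
  have h : (T.B⁻¹ * T.B) 0 j = (1 : Matrix (Fin (r + 1)) (Fin (r + 1)) 𝕂) 0 j := by
    rw [Matrix.nonsing_inv_mul T.B (isUnit_iff_ne_zero.2 T.det_ext_ne)]
  rw [Matrix.mul_apply] at h
  rw [h, Matrix.one_apply]
  induction j using Fin.cases with
  | zero => simp [deg_zero]
  | succ j => rw [deg_succ, if_neg (Fin.succ_ne_zero j).symm, Int.cast_zero]

/-- Row 0 of B⁻¹B = 1 gives the right eigenvalues on the generators, and bracketing with L is a
derivation. -/
theorem br_L {k : ℤ} {y : T.Ctg} (hy : y ∈ T.comp k) : T.pres.br T.L y = (k : 𝕂) • y := by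
  induction hy using Submodule.span_induction with
  | mem y hy =>
    obtain ⟨a, rfl, rfl⟩ := hy
    induction a using FreeMagma.recOnMul with
    | ih1 g =>
      change T.pres.br T.L (T.pres.gen g) = ((Chev.consistent g : ℤ) : 𝕂) • T.pres.gen g
      simp only [coe_L, map_sum, LinearMap.sum_apply, map_smul, LinearMap.smul_apply]
      cases g with
      | e j =>
        simp only [T.br_h_e, smul_smul]
        rw [← Finset.sum_smul, sum_B_inv, deg]
      | f j =>
        simp only [T.br_h_f, smul_smul, mul_neg]
        rw [← Finset.sum_smul, Finset.sum_neg_distrib, sum_B_inv, consistent_f, Int.cast_neg]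
      | h j => simp [T.br_h_h, Chev.consistent]
    | ih2 a b iha ihb =>
      change _ = ((wordDeg T.pres.par a + wordDeg T.pres.par b : ℤ) : 𝕂) • _
      rw [Int.cast_add, ← Pres.mono_mul, ← T.pres.br_mkQ,
        T.pres.br_br_zero T.L.2 (T.pres.mkQ_mono_mem a), iha, ihb, map_smul, map_smul,
        LinearMap.smul_apply, add_smul]
  | zero => rw [map_zero, smul_zero]
  | add b c _ _ h1 h2 => rw [map_add, h1, h2, smul_add]
  | smul c b _ h1 => rw [map_smul, h1, smul_comm]

/-! ### Brackets and forms with `f₀` -/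

variable {T} in
theorem IsRaised.br_step (j : Fin r) {n : Fin r → ℕ} {y : T.Ctg} (hy : T.IsRaised n y) :
    T.pres.br (T.pres.br (T.pres.gen (.e j.succ)) y) (T.pres.gen (.f 0)) =
      T.pres.br (T.pres.gen (.e j.succ)) (T.pres.br y (T.pres.gen (.f 0))) := by
  rw [T.pres.br_br_zero (T.e_succ_mem j) hy.mem, T.br_e_f_ne _ _ (Fin.succ_ne_zero j), map_zero,
    add_zero]

theorem br_e_h_zero (j : Fin r) : T.pres.br (T.pres.gen (.e j.succ)) (T.pres.gen (.h 0)) =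
    -T.B 0 j.succ • T.pres.gen (.e j.succ) := by
  have h := T.pres.br_comm (T.h_mem 0) (T.e_succ_mem j)
  rw [T.br_h_e] at h
  rw [← neg_eq_iff_eq_neg.2 h, neg_smul]

variable {T} in
-- By invariance the outermost e_j moves onto f₀, with which it commutes.
theorem IsRaised.form_eq_zero {Φ : T.Ctg →ₗ[𝕂] T.Ctg →ₗ[𝕂] 𝕂} (hΦ : T.IsStandardForm Φ)
    {n : Fin r → ℕ} {y : T.Ctg} (hy : T.IsRaised n y) (hn : n ≠ 0) :
    Φ (T.pres.gen (.f 0)) y = 0 := by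
  cases hy with
  | zero => exact absurd rfl hn
  | step j n y hy =>
    have h := T.pres.br_comm (T.e_succ_mem j) (T.f_mem 0)
    rw [T.br_e_f_ne _ _ (Fin.succ_ne_zero j)] at h
    rw [← hΦ.invariant, ← neg_eq_iff_eq_neg.2 h, neg_zero, map_zero, LinearMap.zero_apply]

theorem form_f_e {Φ : T.Ctg →ₗ[𝕂] T.Ctg →ₗ[𝕂] 𝕂} (hΦ : T.IsStandardForm Φ) :
    Φ (T.pres.gen (.f 0)) (T.pres.gen (.e 0)) = -1 := by
  have h := hΦ.symm _ _ _ (T.f_mem 0) _ (T.e_mem 0)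
  rw [hΦ.ef_same] at h
  simpa [deg_zero] using h

theorem pairing_zero (μ : Fin r → 𝕂) : T.pairing μ 0 = 0 := by
  rw [pairing, Matrix.mulVec_zero, dotProduct_zero]

section

variable [CharZero 𝕂]

theorem contra_isEquivariant {Φ : T.Ctg →ₗ[𝕂] T.Ctg →ₗ[𝕂] 𝕂} (hΦ : T.IsStandardForm Φ) :
    (T.contra Φ).IsEquivariant where
  L_lie w := Subtype.ext ((T.br_L w.2).trans (by simp))
  lie_pn w y x := Subtype.ext (T.pres.br_br_zero w.2 y.2 x)
  form_lie w x y := by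
    change Φ (T.pres.br w x) y = -Φ x (T.pres.br w y)
    rw [T.pres.br_comm w.2 x.2, map_neg, LinearMap.neg_apply, hΦ.invariant]

/-! ### Weights -/

theorem gram_det_ne : T.gram.det ≠ 0 := by
  have h : T.gram = Matrix.diagonal T.ε * (T.A.map (Int.cast : ℤ → 𝕂)).transpose := by
    ext i j
    rw [Matrix.diagonal_mul, Matrix.transpose_apply, Matrix.map_apply, mul_comm]
    rfl
  have h2 : (T.A.map (Int.cast : ℤ → 𝕂)).det = (T.A.det : 𝕂) :=
    ((Int.castRingHom 𝕂).map_det T.A).symm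
  rw [h, Matrix.det_mul, Matrix.det_diagonal, Matrix.det_transpose, h2]
  exact mul_ne_zero (Finset.prod_ne_zero_iff.2 fun i _ => T.ε_ne i)
    (Int.cast_ne_zero.2 T.det_ne)

/-- The coefficients of `h₀` in the basis `h i`, `i = 1, …, r`, up to an element centralising `𝔤`. -/
noncomputable def coeff : Fin r → 𝕂 := -Matrix.vecMul T.weight T.gram⁻¹

theorem sum_coeff (j : Fin r) : ∑ i, T.coeff i * T.A i j = T.B 0 j.succ := by
  have h : Matrix.vecMul T.coeff T.gram j = -T.weight j := by
    rw [coeff, Matrix.neg_vecMul, Matrix.vecMul_vecMul,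
      Matrix.nonsing_inv_mul _ (isUnit_iff_ne_zero.2 T.gram_det_ne), Matrix.vecMul_one,
      Pi.neg_apply]
  have h2 : Matrix.vecMul T.coeff T.gram j = T.ε j * ∑ i, T.coeff i * T.A i j := by
    rw [Matrix.vecMul, dotProduct, Finset.mul_sum]
    refine Finset.sum_congr rfl fun i _ => ?_
    have h3 := T.symm i j
    have h4 := T.ε_ne i
    have h5 := T.ε_ne j
    -- Symmetry of D⁻¹A means ε_i A_ji = ε_j A_ij.
    change T.coeff i * ((T.A j i : 𝕂) * T.ε i) = _
    field_simp at h3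
    linear_combination -T.coeff i * h3
  rw [B_zero_succ, eq_neg_iff_add_eq_zero, ← mul_right_inj' (T.ε_ne j), mul_add, ← h2, h, mul_zero,
    mul_div_cancel₀ _ (T.ε_ne j)]
  exact neg_add_cancel _

/-- The coefficients are chosen so that both sides agree on the e_j and f_j; the difference is a
derivation killing the generators of 𝔤. -/
theorem lie_eq_sum {x : T.comp 0} (hx : x ∈ T.g) :
    ⁅T.h 0, x⁆ = ∑ i : Fin r, T.coeff i • ⁅T.h i.succ, x⁆ := by
  suffices h : ⁅T.h 0 - ∑ i : Fin r, T.coeff i • T.h i.succ, x⁆ = 0 by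
    simp only [sub_lie, sum_lie, smul_lie] at h
    exact sub_eq_zero.1 h
  induction hx using LieSubalgebra.lieSpan_induction with
  | mem x hx =>
    simp only [sub_lie, sum_lie, smul_lie]
    apply Subtype.ext
    rw [Submodule.coe_sub, Submodule.coe_sum, Submodule.coe_zero]
    simp only [Submodule.coe_smul]
    rcases hx with (⟨j, rfl⟩ | ⟨j, rfl⟩) | ⟨j, rfl⟩
    · change T.pres.br (T.pres.gen _) (T.pres.gen _) -
        ∑ i : Fin r, _ • T.pres.br (T.pres.gen _) (T.pres.gen _) = 0
      simp only [T.br_h_e, smul_smul, B_succ_succ]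
      rw [← Finset.sum_smul, sum_coeff, sub_self]
    · change T.pres.br (T.pres.gen _) (T.pres.gen _) -
        ∑ i : Fin r, _ • T.pres.br (T.pres.gen _) (T.pres.gen _) = 0
      simp only [T.br_h_f, smul_smul, B_succ_succ, mul_neg]
      rw [← Finset.sum_smul, Finset.sum_neg_distrib, sum_coeff, sub_self]
    · change T.pres.br (T.pres.gen _) (T.pres.gen _) -
        ∑ i : Fin r, _ • T.pres.br (T.pres.gen _) (T.pres.gen _) = 0
      simp only [T.br_h_h, smul_zero, Finset.sum_const_zero, sub_self]
  | zero => rw [lie_zero]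
  | add x y _ _ h1 h2 => rw [lie_add, h1, h2, add_zero]
  | smul c x _ h1 => rw [lie_smul, h1, smul_zero]
  | lie x y _ _ h1 h2 => rw [leibniz_lie, h1, h2, zero_lie, lie_zero, add_zero]

variable {T} in
/-- `h₀` acts on the weight space of weight `β` as `-(λ, β)`. -/
theorem HasWeight.lie_h_zero {β : Fin r → 𝕂} {x : T.comp 0} (hx : T.HasWeight β x) :
    T.pres.br (T.pres.gen (.h 0)) x = -T.pairing T.weight β • (x : T.Ctg) := by
  have h := T.lie_eq_sum hx.1
  simp only [hx.2, smul_smul] at h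
  rw [← Finset.sum_smul] at h
  have h2 : ∑ i, T.coeff i * β i = -T.pairing T.weight β := by
    rw [pairing, Matrix.dotProduct_mulVec, ← neg_dotProduct]
    rfl
  rw [h2] at h
  exact congrArg Subtype.val h

variable {T} in
/-- A root vector on which `h₀` acts as `-c` can only exist if `c` is `0`, `1` or `-1`. -/
theorem IsPseudoMinuscule.eq_of_hasWeight (hmin : T.IsPseudoMinuscule T.weightUp)
    {β : Fin r → 𝕂} {x : T.comp 0} (hx : T.HasWeight β x) (hx0 : (x : T.Ctg) ≠ 0) {c : 𝕂}
    (hc : T.pres.br (T.pres.gen (.h 0)) x = -c • (x : T.Ctg)) :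
    T.pairing T.weight β = c ∧ (c = 0 ∨ T.IsRoot β ∧ (c = 1 ∨ c = -1)) := by
  have h1 : T.pairing T.weight β = c := by
    rw [hx.lie_h_zero] at hc
    exact neg_injective (smul_left_injective 𝕂 hx0 hc)
  refine ⟨h1, or_iff_not_imp_left.2 fun h0 => ?_⟩
  have hβ : T.IsRoot β := by
    -- A weight with (λ, β) ≠ 0 is nonzero, hence a root.
    refine ⟨fun hβ => h0 ?_, x, fun h => hx0 (by rw [h]; rfl), hx⟩
    rw [← h1, hβ, pairing_zero]
  have hw : (fun i => T.ε i * T.weightUp i) = T.weight := by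
    ext i
    rw [weightUp, mul_inv_cancel_left₀ (T.ε_ne i)]
  have h2 := hmin.2 β hβ
  rw [hw, h1] at h2
  exact ⟨hβ, h2.resolve_left h0⟩

variable {T} in
theorem IsPseudoMinuscule.exists_nat (hmin : T.IsPseudoMinuscule T.weightUp) :
    ∃ m : Fin r → ℕ, ∀ i, T.B 0 i.succ = -(m i : 𝕂) ∧ (m i = 0 ↔ T.lam i = 0) := by
  obtain ⟨m, hm⟩ := hmin.1
  refine ⟨m, fun i => ⟨?_, ?_⟩⟩
  · rw [← hm, B_zero_succ, weightUp, weight, div_eq_inv_mul]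
  · rw [← Nat.cast_eq_zero (R := 𝕂), ← hm, weightUp, weight, mul_eq_zero, Nat.cast_eq_zero]
    simp [T.ε_ne i]

/-! ### Brackets with `f₀` -/

variable {T} in
-- On f_j the eigenvalue is the label λ_j/ε_j of λ^▲, a natural number, and on f₀ it is 0;
-- eigenvalues add along a word.
theorem isWord_f_lie_h_zero (hmin : T.IsPseudoMinuscule T.weightUp) {k : ℤ} {w : T.Ctg}
    (hw : T.pres.IsWord (fun i => -deg i) (fun i => T.pres.gen (.f i)) k w) :
    ∃ m : ℕ, T.pres.br (T.pres.gen (.h 0)) w = (m : 𝕂) • w := by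
  have hf : ∀ i, ∃ m : ℕ, T.pres.br (T.pres.gen (.h 0)) (T.pres.gen (.f i)) =
      (m : 𝕂) • T.pres.gen (.f i) := by
    intro i
    induction i using Fin.cases with
    | zero => exact ⟨0, by rw [T.br_h_zero_f_zero, Nat.cast_zero, zero_smul]⟩
    | succ j =>
      obtain ⟨m, hm⟩ := hmin.exists_nat
      exact ⟨m j, by rw [T.br_h_f, (hm j).1, neg_neg]⟩
  induction hw with
  | of i k hk => exact hf i
  | br i k l w hw hk ih =>
    obtain ⟨a, ha⟩ := hf i
    obtain ⟨b, hb⟩ := ih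
    refine ⟨a + b, ?_⟩
    rw [T.pres.br_br_zero (T.h_mem 0) (T.f_mem i), ha, hb, map_smul, map_smul,
      LinearMap.smul_apply, Nat.cast_add, add_smul]

variable {T} in
-- Since h₀ commutes with f₀, the bracket ⟦x, f₀⟧ keeps eigenvalue -1. In the triangular
-- decomposition of x, the e-words commute with f₀ and the other parts contribute only natural
-- eigenvalues. Independence of eigenspaces leaves zero.
theorem br_f_zero_eq_zero (hmin : T.IsPseudoMinuscule T.weightUp) {x : T.Ctg} (hx : x ∈ T.comp 0)
    (h : T.pres.br (T.pres.gen (.h 0)) x = -x) : T.pres.br x (T.pres.gen (.f 0)) = 0 := by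
  let φ : Module.End 𝕂 T.Ctg := T.pres.br (T.pres.gen (.h 0))
  have hφ : ∀ w : T.Ctg, w ∈ T.comp 0 → ∀ c : 𝕂, φ w = c • w →
      T.pres.br w (T.pres.gen (.f 0)) ∈ φ.eigenspace c := by
    intro w hw c hc
    rw [Module.End.mem_eigenspace_iff]
    change T.pres.br _ _ = c • w at hc
    change T.pres.br _ (T.pres.br _ _) = _
    rw [T.pres.br_br_zero (T.h_mem 0) hw, hc, T.br_h_zero_f_zero, map_zero, add_zero, map_smul,
      LinearMap.smul_apply]
  have hw_mem : ∀ {k : ℤ} {w : T.Ctg},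
      T.pres.IsWord (fun i => -deg i) (fun i => T.pres.gen (.f i)) k w → w ∈ T.comp k := by
    intro k w hw
    induction hw with
    | of i k hk => exact hk ▸ T.f_mem i
    | br i k l w hw hk ih => exact T.pres.br_mem hk.symm (T.f_mem i) ih
  have h1 : T.pres.br x (T.pres.gen (.f 0)) ∈ φ.eigenspace (-1) :=
    hφ x hx _ (by rw [neg_one_smul]; exact h)
  have h2 : T.pres.br x (T.pres.gen (.f 0)) ∈ ⨆ c, ⨆ (_ : c ≠ (-1 : 𝕂)), φ.eigenspace c := by
    have hnat : ∀ m : ℕ, (m : 𝕂) ≠ -1 := fun m hm => by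
      rw [eq_neg_iff_add_eq_zero] at hm
      exact Nat.cast_add_one_ne_zero m hm
    have hle : T.comp 0 ≤ (⨆ c, ⨆ (_ : c ≠ (-1 : 𝕂)), φ.eigenspace c).comap
        (T.pres.br.flip (T.pres.gen (.f 0))) := by
      refine (T.comp_le_triangular 0).trans (sup_le (sup_le ?_ ?_) ?_) <;>
        refine Submodule.span_le.2 fun w hw => ?_
      · rw [SetLike.mem_coe, Submodule.mem_comap, LinearMap.flip_apply,
          ((T.isWord_e hw).2.2.1 rfl).1]
        exact zero_mem _
      · obtain ⟨-, i, rfl⟩ := hw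
        refine Submodule.mem_iSup_of_mem 0 (Submodule.mem_iSup_of_mem ?_
          (hφ _ (T.h_mem i) 0 ?_))
        · simp
        · rw [zero_smul]
          exact T.br_h_h 0 i
      · obtain ⟨m, hm⟩ := isWord_f_lie_h_zero hmin hw
        exact Submodule.mem_iSup_of_mem _ (Submodule.mem_iSup_of_mem (hnat m)
          (hφ _ (hw_mem hw) _ hm))
    exact hle hx
  exact Submodule.disjoint_def.1 (φ.eigenspaces_iSupIndep (-1)) _ h1 h2

variable {T} in
-- The weights of e₀ and f₀ cancel, so only the raising e_j contribute.
theorem IsRaised.br_h {n : Fin r → ℕ} {y : T.Ctg} (hy : T.IsRaised n y) (i : Fin (r + 1)) :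
    T.pres.br (T.pres.gen (.h i)) (T.pres.br y (T.pres.gen (.f 0))) =
      (∑ j, n j * T.B i j.succ) • T.pres.br y (T.pres.gen (.f 0)) := by
  induction hy with
  | zero => simp [T.br_e_f_same, T.br_h_h]
  | step j n y hy ih =>
    rw [hy.br_step, T.pres.br_br_zero (T.h_mem i) (T.e_succ_mem j), ih, T.br_h_e, map_smul,
      map_smul, LinearMap.smul_apply, ← add_smul]
    congr 1
    simp [add_mul, Finset.sum_add_distrib, Pi.single_apply, add_comm]

theorem e_mem_g (j : Fin r) : T.e j ∈ T.g :=
  LieSubalgebra.subset_lieSpan (.inl (.inl ⟨j, rfl⟩))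

variable {T} in
-- The innermost e_j meets ⟦e₀, f₀⟧ = h₀ and turns it into a multiple of e_j; from there on
-- everything stays in 𝔤.
theorem IsRaised.mem_g {n : Fin r → ℕ} {y : T.Ctg} (hy : T.IsRaised n y) (hn : n ≠ 0) :
    ∃ q ∈ T.g, (q : T.Ctg) = T.pres.br y (T.pres.gen (.f 0)) := by
  induction hy with
  | zero => exact absurd rfl hn
  | step j n y hy ih =>
    rw [hy.br_step]
    by_cases h0 : n = 0
    · rw [hy.eq h0, T.br_e_f_same, br_e_h_zero]
      exact ⟨_, T.g.smul_mem _ (T.e_mem_g j), rfl⟩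
    · obtain ⟨q, hq, h⟩ := ih h0
      rw [← h]
      exact ⟨⁅T.e j, q⁆, T.g.lie_mem (T.e_mem_g j) hq, rfl⟩

variable {T} in
-- The innermost e_j already commutes with h₀ when λ_j = 0.
theorem IsRaised.br_eq_zero {n : Fin r → ℕ} {y : T.Ctg} (hy : T.IsRaised n y) (hn : n ≠ 0)
    (h : ∀ j, n j = 0 ∨ T.lam j = 0) : T.pres.br y (T.pres.gen (.f 0)) = 0 := by
  induction hy with
  | zero => exact absurd rfl hn
  | step j n y hy ih =>
    rw [hy.br_step]
    by_cases h0 : n = 0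
    · have h1 : T.lam j = 0 := (h j).resolve_left (by simp)
      rw [hy.eq h0, T.br_e_f_same, br_e_h_zero, B_zero_succ, h1]
      simp
    · rw [ih h0 fun i => (h i).imp_left fun hi => ?_, map_zero]
      rw [Pi.add_apply] at hi
      lia

variable {T} in
theorem IsRaised.hasWeight {n : Fin r → ℕ} {y : T.Ctg} (hy : T.IsRaised n y) (hn : n ≠ 0) :
    ∃ (β : Fin r → 𝕂) (q : T.comp 0), T.HasWeight β q ∧
      (q : T.Ctg) = T.pres.br y (T.pres.gen (.f 0)) := by
  obtain ⟨q, hq, h⟩ := hy.mem_g hn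
  refine ⟨fun i => ∑ j, n j * T.B i.succ j.succ, q, ⟨hq, fun i => Subtype.ext ?_⟩, h⟩
  change T.pres.br (T.pres.gen (.h i.succ)) q = _ • (q : T.Ctg)
  rw [h, hy.br_h]

variable {T} in
/-- For `y` in a root space of `ℬ₁` other than that of `e₀`, the bracket `⟦y, f₀⟧` has eigenvalue
`-1` with respect to `h₀`. -/
theorem IsRaised.br_h_zero (hmin : T.IsPseudoMinuscule T.weightUp)
    {n : Fin r → ℕ} {y : T.Ctg} (hy : T.IsRaised n y) (hn : n ≠ 0) :
    T.pres.br (T.pres.gen (.h 0)) (T.pres.br y (T.pres.gen (.f 0))) =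
      -T.pres.br y (T.pres.gen (.f 0)) := by
  by_cases h0 : T.pres.br y (T.pres.gen (.f 0)) = 0
  · rw [h0, map_zero, neg_zero]
  obtain ⟨β, q, hq, h⟩ := hy.hasWeight hn
  obtain ⟨m, hm⟩ := hmin.exists_nat
  have h1 := hy.br_h 0
  have h2 : ∑ j, (n j : 𝕂) * T.B 0 j.succ = -((∑ j, n j * m j : ℕ) : 𝕂) := by
    push_cast
    rw [← Finset.sum_neg_distrib]
    exact Finset.sum_congr rfl fun j _ => by rw [(hm j).1, mul_neg]
  rw [h2] at h1
  -- Here c = ∑ n_j m_j is a natural number. If c = 0, every e_j used has λ_j = 0 and the bracket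
  -- vanishes; c = -1 is impossible in characteristic zero.
  rcases (hmin.eq_of_hasWeight hq (h ▸ h0) (h ▸ h1)).2 with h3 | ⟨-, h3 | h3⟩
  · rw [Nat.cast_eq_zero, Finset.sum_eq_zero_iff] at h3
    refine absurd (hy.br_eq_zero hn fun j => ?_) h0
    rw [← (hm j).2]
    exact mul_eq_zero.1 (h3 j (Finset.mem_univ j))
  · rw [h1, h3, neg_one_smul]
  · rw [eq_neg_iff_add_eq_zero] at h3
    exact absurd h3 (Nat.cast_add_one_ne_zero _)

variable {T} in
theorem pairBr_eq_zero {Φ : T.Ctg →ₗ[𝕂] T.Ctg →ₗ[𝕂] 𝕂} {w : T.comp 0}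
    (h : ∀ n y, T.IsRaised n y → T.pres.br (T.pres.br w y) (T.pres.gen (.f 0)) +
      Φ (T.pres.gen (.f 0)) y • (w : T.Ctg) -
        Φ (T.pres.gen (.f 0)) (T.pres.br w y) • (T.L : T.Ctg) = 0) (y : T.comp 1) :
    (T.contra Φ).pairBr y T.f₀ w = 0 := by
  have key : T.pres.br (T.pres.br w y) (T.pres.gen (.f 0)) +
      Φ (T.pres.gen (.f 0)) y • (w : T.Ctg) -
        Φ (T.pres.gen (.f 0)) (T.pres.br w y) • (T.L : T.Ctg) = 0 := by
    obtain ⟨y, hy⟩ := y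
    have hy' := T.comp_one_le hy
    dsimp only
    clear hy
    induction hy' using Submodule.span_induction with
    | mem y hy =>
      obtain ⟨n, hn⟩ := hy
      exact h n y hn
    | zero => simp
    | add a b _ _ h1 h2 =>
      rw [← add_zero (0 : T.Ctg)]
      nth_rewrite 1 [← h1]
      rw [← h2]
      simp only [map_add, LinearMap.add_apply, add_smul]
      abel
    | smul c a _ h1 =>
      have h2 := congrArg (c • ·) h1
      simpa only [map_smul, LinearMap.smul_apply, smul_sub, smul_add, smul_smul, smul_eq_mul,
        smul_zero] using h2
  apply Subtype.ext
  change -T.pres.br (T.pres.br w y) (T.pres.gen (.f 0)) - Φ (T.pres.gen (.f 0)) y • (w : T.Ctg) +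
    Φ (T.pres.gen (.f 0)) (T.pres.br w y) • (T.L : T.Ctg) = 0
  rw [← neg_eq_zero, ← key]
  abel

/-! ### Vanishing of the products with f₀ -/

variable {T} in
theorem prodLocal_h_add_L {Φ : T.Ctg →ₗ[𝕂] T.Ctg →ₗ[𝕂] 𝕂} (hΦ : T.IsStandardForm Φ)
    (hmin : T.IsPseudoMinuscule T.weightUp) :
    (T.contra Φ).prodLocal T.f₀ (T.h 0 + T.L) = 0 := by
  refine ContraData.prodLocal_eq_zero (T.contra_isEquivariant hΦ) (pairBr_eq_zero ?_)
  intro n y hy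
  have hw : ((T.h 0 + T.L : T.comp 0) : T.Ctg) = T.pres.gen (.h 0) + T.L := rfl
  have hL : T.pres.br T.L y = y := by rw [T.br_L hy.mem, Int.cast_one, one_smul]
  rw [hw, map_add, LinearMap.add_apply, hL]
  by_cases hn : n = 0
  -- With ⟨f₀|e₀⟩ = -1 the expression is h₀ - (h₀ + L) + L.
  · rw [hy.eq hn, T.br_h_zero_e_zero, zero_add, T.br_e_f_same, T.form_f_e hΦ, neg_one_smul,
      neg_one_smul]
    abel
  · have h1 := T.pres.br_comm (T.h_mem 0) (T.f_mem 0)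
    rw [T.br_h_zero_f_zero, eq_comm, neg_eq_zero] at h1
    have h2 := T.pres.br_br_zero (T.h_mem 0) hy.mem (T.pres.gen (.f 0))
    rw [T.br_h_zero_f_zero, map_zero, add_zero, hy.br_h_zero hmin hn] at h2
    -- Both form terms vanish, and the eigenvalue -1 of h₀ on ⟦y, f₀⟧ cancels the +1 coming from L
    -- acting on y.
    rw [map_add, map_add, ← hΦ.invariant, h1, hy.form_eq_zero hΦ hn, map_zero,
      LinearMap.zero_apply, LinearMap.add_apply, ← h2]
    simp

variable {T} in
theorem prodLocal_of_hasWeight {Φ : T.Ctg →ₗ[𝕂] T.Ctg →ₗ[𝕂] 𝕂} (hΦ : T.IsStandardForm Φ)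
    (hmin : T.IsPseudoMinuscule T.weightUp) {β : Fin r → 𝕂}
    (hβ : T.pairing T.weight β = 1) {x : T.comp 0} (hx : T.HasWeight β x) :
    (T.contra Φ).prodLocal T.f₀ x = 0 := by
  refine ContraData.prodLocal_eq_zero (T.contra_isEquivariant hΦ) (pairBr_eq_zero ?_)
  intro n y hy
  have h0 : T.pres.br (T.pres.gen (.h 0)) x = -(x : T.Ctg) := by
    rw [hx.lie_h_zero, hβ, neg_one_smul]
  have h1 := br_f_zero_eq_zero hmin x.2 h0
  have h2 := T.pres.br_comm x.2 (T.f_mem 0)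
  rw [h1, eq_comm, neg_eq_zero] at h2
  have h3 := T.pres.br_br_zero x.2 hy.mem (T.pres.gen (.f 0))
  rw [h1, map_zero, add_zero] at h3
  rw [← hΦ.invariant, h2, map_zero, LinearMap.zero_apply, zero_smul, sub_zero, ← h3]
  by_cases hn : n = 0
  · have h4 := T.pres.br_comm (T.h_mem 0) x.2
    rw [h0, neg_inj] at h4
    rw [hy.eq hn, T.br_e_f_same, T.form_f_e hΦ, ← h4, neg_one_smul, add_neg_cancel]
  · rw [hy.form_eq_zero hΦ hn, zero_smul, add_zero]
    -- The eigenvalues -1 of h₀ on x and on q add up: a nonzero bracket would be a weight vector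
    -- with (λ, β + γ) = 2, which is excluded.
    by_contra hne
    obtain ⟨γ, q, hq, hqy⟩ := hy.hasWeight hn
    have hz := hy.br_h_zero hmin hn
    rw [← hqy] at hz hne
    have hw : T.HasWeight (β + γ) ⁅x, q⁆ := by
      refine ⟨T.g.lie_mem hx.1 hq.1, fun i => ?_⟩
      rw [leibniz_lie, hx.2, hq.2, smul_lie, lie_smul, Pi.add_apply, add_smul]
    have h5 : T.pres.br (T.pres.gen (.h 0)) (⁅x, q⁆ : T.comp 0) =
        -2 • ((⁅x, q⁆ : T.comp 0) : T.Ctg) := by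
      change T.pres.br _ (T.pres.br x q) = -2 • T.pres.br x q
      rw [T.pres.br_br_zero (T.h_mem 0) x.2, h0, hz, map_neg, map_neg, LinearMap.neg_apply,
        neg_smul, two_smul, neg_add]
    have h6 := (hmin.eq_of_hasWeight hw hne (c := 2) (by rw [h5]; module)).2
    norm_num at h6

variable {T} in
theorem hasWeight_e {Φ : T.Ctg →ₗ[𝕂] T.Ctg →ₗ[𝕂] 𝕂} (hΦ : T.IsStandardForm Φ)
    (hmin : T.IsPseudoMinuscule T.weightUp) {j : Fin r} (hj : T.lam j ≠ 0) :
    ∃ β, T.pairing T.weight β = 1 ∧ T.HasWeight β (T.e j) := by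
  obtain ⟨m, hm⟩ := hmin.exists_nat
  -- The generator survives in the quotient because ⟨e_j|f_j⟩ = ε_j is nonzero.
  have h0 : ((T.e j : T.comp 0) : T.Ctg) ≠ 0 := by
    intro h
    have h1 := hΦ.ef_same j.succ
    change Φ (T.e j : T.Ctg) _ = T.ε j at h1
    rw [h, map_zero, LinearMap.zero_apply] at h1
    exact T.ε_ne j h1.symm
  have hw : T.HasWeight (fun i => T.B i.succ j.succ) (T.e j) :=
    ⟨T.e_mem_g j, fun i => Subtype.ext (T.br_h_e i.succ j.succ)⟩
  have h1 : T.pres.br (T.pres.gen (.h 0)) (T.e j) = -(m j : 𝕂) • (T.e j : T.Ctg) := by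
    rw [← (hm j).1]
    exact T.br_h_e 0 j.succ
  obtain ⟨h2, h3⟩ := hmin.eq_of_hasWeight hw h0 h1
  refine ⟨_, ?_, hw⟩
  rw [h2]
  -- The pairing is the natural number m_j, nonzero because λ_j is; of the values 0, 1, -1 only 1
  -- remains.
  rcases h3 with h3 | ⟨-, h3 | h3⟩
  · rw [Nat.cast_eq_zero] at h3
    exact absurd ((hm j).2.1 h3) hj
  · exact h3
  · rw [eq_neg_iff_add_eq_zero] at h3
    exact absurd h3 (Nat.cast_add_one_ne_zero _)

end

end Triple

end Cartanify

theorem proposition3p2 {𝕂 : Type*} [Field 𝕂] [IsAlgClosed 𝕂] [CharZero 𝕂] {r : ℕ}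
    (T : Cartanify.Triple 𝕂 r)
    (Φ : T.Ctg →ₗ[𝕂] T.Ctg →ₗ[𝕂] 𝕂) (hΦ : T.IsStandardForm Φ)
    (hmin : T.IsPseudoMinuscule T.weightUp) :
    -- in the local cartanification
    ((T.contra Φ).prodLocal T.f₀ (T.h 0 + T.L) = 0 ∧
      (∀ β, T.IsRoot β → T.pairing T.weight β = 1 →
        ∀ x, T.HasWeight β x → (T.contra Φ).prodLocal T.f₀ x = 0) ∧
      ∀ j, T.lam j ≠ 0 → (T.contra Φ).prodLocal T.f₀ (T.e j) = 0) ∧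
    -- in the cartanification
    ((T.contra Φ).prod T.f₀ (T.h 0 + T.L) = 0 ∧
      (∀ β, T.IsRoot β → T.pairing T.weight β = 1 →
        ∀ x, T.HasWeight β x → (T.contra Φ).prod T.f₀ x = 0) ∧
      ∀ j, T.lam j ≠ 0 → (T.contra Φ).prod T.f₀ (T.e j) = 0) := by
  have h1 := Cartanify.Triple.prodLocal_h_add_L hΦ hmin
  have h2 : ∀ β, T.IsRoot β → T.pairing T.weight β = 1 →
      ∀ x, T.HasWeight β x → (T.contra Φ).prodLocal T.f₀ x = 0 :=
    fun β _ hβ x hx => Cartanify.Triple.prodLocal_of_hasWeight hΦ hmin hβ hx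
  have h3 : ∀ j, T.lam j ≠ 0 → (T.contra Φ).prodLocal T.f₀ (T.e j) = 0 := fun j hj => by
    obtain ⟨β, hβ, hx⟩ := Cartanify.Triple.hasWeight_e hΦ hmin hj
    exact Cartanify.Triple.prodLocal_of_hasWeight hΦ hmin hβ hx
  exact ⟨⟨h1, h2, h3⟩, Cartanify.ContraData.prod_eq_zero h1,
    fun β hβ hβ1 x hx => Cartanify.ContraData.prod_eq_zero (h2 β hβ hβ1 x hx),
    fun j hj => Cartanify.ContraData.prod_eq_zero (h3 j hj)⟩
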